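/- Let $\mathcal H$ be a real reproducing kernel Hilbert space of functions on $\mathcal X$ with kernel $K$, and let $P_X$ be a probability distribution on $\mathcal X$. Suppose that $K(x,x')=\sum_{i\ge1}\mu_i\phi_i(x)\phi_i(x')$ for all $x,x'\in\mathcal X$, where $\mu_1\ge\mu_2\ge\dots\ge0$ and $(\phi_i)_{i\ge1}$ is an orthonormal basis of $L^2(P_X)$ with $\sup_i\sup_x|\phi_i(x)|<\infty$. Let $x_1,x_2,\dots$ be i.i.d. with law $P_X$, let $\epsilon_1,\epsilon_2,\dots$ be i.i.d. $N(0,\sigma^2)$ with $\sigma>0$, independent of $(x_i)$, and let $y_i=f(x_i)+\epsilon_i$ with $f\in\mathcal H$. For $n\ge1$ let $\boldsymbol K=(K(x_i,x_j)/n)_{i,j\le n}$, with eigenvalues $\widehat\mu_1\ge\dots\ge\widehat\mu_n\ge0$ and $\Lambda=\mathrm{diag}(\widehat\mu_1,\dots,\widehat\mu_n)$. For step sizes $\alpha_0,\alpha_1,\dots$, which may depend (measurably) on $n$ and on $x_1,\dots,x_n$, let $f_0=0$ and $f_{t+1}=f_t-\frac{\alpha_t}{n}\sum_{i=1}^n(f_t(x_i)-y_i)K(x_i,\cdot)$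 be the functional gradient descent iterates for the loss $\frac1{2n}\sum_{i=1}^n(y_i-f(x_i))^2$, and put $$D_{n,t}=\frac1n\sum_{i=1}^nf_t(x_i)^2,\quad S^t=\prod_{\tau=0}^{t-1}(I_n-\alpha_\tau\Lambda),\quad \eta_t=\sum_{\tau=0}^{t-1}\alpha_\tau,\quad \kappa_t=\min\{j\ge1:\mu_j<1/\eta_t\}-1 .$$ Assume that (i) for every $n\ge 1$, almost surely, the step sizes are nonincreasing and $0\le\alpha_\tau\le\min\{1,1/\widehat\mu_1\}$ for all $\tau$; (ii) $\eta_t\to\infty$ as $n,t\to\infty$; (iii) $\eta_{t_1}/\eta_{t_2}\to0$ whenever $n,t_2\to\infty$ and $t_1/t_2\to0$; (iv) $\kappa_t\to\infty$ as $n,t\to\infty$. In (ii)-(iv) the limits are meant in probability; if $(\alpha_\tau)$ is a fixed sequence they are ordinary limits as $t\to\infty$ (resp. $t_2\to\infty$). Then, under $H_0:f=0$, for all $n\ge1$ and $t\ge0$, almost surely, $$\mu_{n,t}:=\mathbb E[D_{n,t}\mid x_1,\dots,x_n]=\frac{\sigma^2}{n}\operatorname{tr}\big((I_n-S^t)^2\big),\qquad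 \sigma_{n,t}^2:=\operatorname{Var}[D_{n,t}\mid x_1,\dots,x_n]=\frac{2\sigma^4}{n^2}\operatorname{tr}\big((I_n-S^t)^4\big),$$ and, as $n\to\infty$ and $t\to\infty$ (jointly, with no relation between $n$ and $t$), $$\frac{D_{n,t}-\mu_{n,t}}{\sigma_{n,t}}\overset{d}{\longrightarrow}N(0,1),$$ both unconditionally and conditionally on the design: for every bounded continuous $g:\mathbb R\to\mathbb R$, $\mathbb E\big[g\big((D_{n,t}-\mu_{n,t})/\sigma_{n,t}\big)\mid x_1,\dots,x_n\big]\to\mathbb E\,g(Z)$ in probability, where $Z\sim N(0,1)$. -/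

import Mathlib

open Filter Topology MeasureTheory ProbabilityTheory

noncomputable section

namespace EarlyStopping

/-! ### Kernel, Mercer expansion -/

section Kernel

variable {𝒳 : Type*} (H : Type*) [NormedAddCommGroup H] [InnerProductSpace ℝ H]
  [CompleteSpace H] [RKHS ℝ H 𝒳 ℝ]

/-- The reproducing kernel `K(x, x')` of the reproducing kernel Hilbert space `H` of real valued
functions on `𝒳`. -/
def kern (x x' : 𝒳) : ℝ := RKHS.kernel H x x' 1

theorem kern_symm (x x' : 𝒳) : kern H x x' = kern H x' x := by
  have h : ∀ a b : 𝒳, kern H a b = inner ℝ (RKHS.kerFun H a 1) (RKHS.kerFun H b 1) := by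
    intro a b
    rw [RKHS.kerFun_inner, RKHS.kerFun_apply]
    simp [kern]
  rw [h, h, real_inner_comm]

/-- `(μ, φ)` is a Mercer system of the kernel of `H` with respect to the distribution `PX`:
nonincreasing nonnegative eigenvalues, eigenfunctions that form an orthonormal basis of `L²(PX)`,
and the expansion `K(x, x') = ∑ᵢ μᵢ φᵢ(x) φᵢ(x')`. The indices start at `0`. -/
structure IsMercerSystem [MeasurableSpace 𝒳] (PX : Measure 𝒳) (μ : ℕ → ℝ) (φ : ℕ → 𝒳 → ℝ) :
    Prop where
  antitone : Antitone μ
  nonneg : ∀ i, 0 ≤ μ i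
  measurable : ∀ i, Measurable (φ i)
  memLp : ∀ i, MemLp (φ i) 2 PX
  orthonormal : ∀ i j, ∫ z, φ i z * φ j z ∂PX = if i = j then 1 else 0
  complete : ∀ g : 𝒳 → ℝ, MemLp g 2 PX → (∀ i, ∫ z, φ i z * g z ∂PX = 0) → g =ᵐ[PX] 0
  expansion : ∀ x x', HasSum (fun i => μ i * φ i x * φ i x') (kern H x x')

/-- The empirical kernel matrix with entries `K(xᵢ, xⱼ) / n`. -/
def empKernel {n : ℕ} (x : Fin n → 𝒳) : Matrix (Fin n) (Fin n) ℝ :=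
  Matrix.of fun i j => (1 / (n : ℝ)) * kern H (x i) (x j)

theorem empKernel_isHermitian {n : ℕ} (x : Fin n → 𝒳) : (empKernel H x).IsHermitian := by
  ext i j
  simp [empKernel, kern_symm H (x j) (x i)]

/-- The eigenvalues of the empirical kernel matrix, in nonincreasing order. -/
def empEig {n : ℕ} (x : Fin n → 𝒳) (j : Fin n) : ℝ :=
  (empKernel_isHermitian H x).eigenvalues₀ (j.cast (Fintype.card_fin n).symm)

/-- The diagonal shrinkage matrix `Sᵗ = ∏_{τ < t} (I - α_τ Λ)`, with `Λ` the diagonal matrix of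
the eigenvalues of the empirical kernel matrix. -/
def shrink {n : ℕ} (α : ℕ → ℝ) (x : Fin n → 𝒳) : ℕ → Matrix (Fin n) (Fin n) ℝ
  | 0 => 1
  | t + 1 => shrink α x t * (1 - α t • Matrix.diagonal (empEig H x))

end Kernel

/-! ### Gradient descent and the Wald statistic -/

section Descent

variable {𝒳 : Type*} {H : Type*} [NormedAddCommGroup H] [InnerProductSpace ℝ H]
  [CompleteSpace H] [RKHS ℝ H 𝒳 ℝ]

/-- The gradient `n⁻¹ ∑ᵢ (f(xᵢ) - yᵢ) K(xᵢ, ·)` at `f` of the least squares loss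
`(2n)⁻¹ ∑ᵢ (yᵢ - f(xᵢ))²` on `H`. -/
def lossGrad {n : ℕ} (x : Fin n → 𝒳) (y : Fin n → ℝ) (f : H) : H :=
  (1 / (n : ℝ)) • ∑ i, (f (x i) - y i) • RKHS.kerFun H (x i) 1

variable (H) in
/-- Functional gradient descent in `H`, started at `0`, with step sizes `α`. -/
def gdIterate {n : ℕ} (α : ℕ → ℝ) (x : Fin n → 𝒳) (y : Fin n → ℝ) : ℕ → H
  | 0 => 0
  | t + 1 => gdIterate α x y t - α t • lossGrad x y (gdIterate α x y t)

variable (H) in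
/-- The statistic `D = ‖f_t‖ₙ² = n⁻¹ ∑ᵢ f_t(xᵢ)²`. -/
def waldStat {n : ℕ} (α : ℕ → ℝ) (x : Fin n → 𝒳) (y : Fin n → ℝ) (t : ℕ) : ℝ :=
  (1 / (n : ℝ)) * ∑ i, gdIterate H α x y t (x i) ^ 2

/-- The responses `yᵢ = f(xᵢ) + εᵢ`. -/
def response {n : ℕ} (f : H) (x : Fin n → 𝒳) (e : Fin n → ℝ) : Fin n → ℝ :=
  fun i => f (x i) + e i

variable (H) in
/-- `(v / n) tr((I - Sᵗ)²)`, with `v` the variance of the noise. -/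
def nullMean {n : ℕ} (v : ℝ) (α : ℕ → ℝ) (x : Fin n → 𝒳) (t : ℕ) : ℝ :=
  v / n * ((1 - shrink H α x t) ^ 2).trace

variable (H) in
/-- `(2 v² / n²) tr((I - Sᵗ)⁴)`, with `v` the variance of the noise. -/
def nullVar {n : ℕ} (v : ℝ) (α : ℕ → ℝ) (x : Fin n → 𝒳) (t : ℕ) : ℝ :=
  2 * v ^ 2 / (n : ℝ) ^ 2 * ((1 - shrink H α x t) ^ 4).trace

end Descent

/-! ### Step sizes -/

/-- The total step size `η_t = ∑_{τ < t} α_τ`. -/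
def totalStep (α : ℕ → ℝ) (t : ℕ) : ℝ := ∑ τ ∈ Finset.range t, α τ

/-- `κ = argmin {j : μ_j < 1/η} - 1` for eigenvalues numbered from `1`, which is the first `j` with
`μ_j < 1/η` for eigenvalues numbered from `0`. For `η = 0` (where `1/η` means `∞`) this is `0`, as
it should be. -/
def kappa (μ : ℕ → ℝ) (η : ℝ) : ℕ := sInf {j | μ j < 1 / η}

/-- The first `n` terms of a sequence of random variables. -/
def sample {Ω E : Type*} (Z : ℕ → Ω → E) (n : ℕ) (ω : Ω) : Fin n → E := fun i => Z i ω

/-- A rule for the step sizes: to a sample size `n` and a design `x₁, …, xₙ` it assigns the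
sequence `(α_τ)_τ`. A fixed sequence is the case where `n` and the design are ignored. -/
abbrev StepRule (𝒳 : Type*) : Type _ := (n : ℕ) → (Fin n → 𝒳) → ℕ → ℝ

/-- The total step size `η_t` for the first `n` points of the random design. -/
def etaR {Ω 𝒳 : Type*} (X : ℕ → Ω → 𝒳) (α : StepRule 𝒳) (n t : ℕ) (ω : Ω) : ℝ :=
  totalStep (α n (sample X n ω)) t

/-- The conditions on the step sizes. Since they may depend on the random design, the bounds hold
almost surely and the limits hold in probability, as `n, t → ∞` jointly; for a fixed sequence of
step sizes the latter are the usual limits. -/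
structure StepSizeConditions {Ω 𝒳 : Type*} [MeasurableSpace Ω] [MeasurableSpace 𝒳]
    (H : Type*) [NormedAddCommGroup H] [InnerProductSpace ℝ H] [CompleteSpace H] [RKHS ℝ H 𝒳 ℝ]
    (P : Measure Ω) (X : ℕ → Ω → 𝒳) (α : StepRule 𝒳) : Prop where
  measurable : ∀ n τ, Measurable fun x => α n x τ
  /-- the step sizes are nonincreasing -/
  antitone : ∀ n, 1 ≤ n → ∀ᵐ ω ∂P, Antitone (α n (sample X n ω))
  nonneg : ∀ n, 1 ≤ n → ∀ᵐ ω ∂P, ∀ τ, 0 ≤ α n (sample X n ω) τ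
  le_one : ∀ n, 1 ≤ n → ∀ᵐ ω ∂P, ∀ τ, α n (sample X n ω) τ ≤ 1
  /-- `α_τ ≤ 1 / λ` for the largest eigenvalue `λ` of the empirical kernel matrix, written for all
  eigenvalues and without division -/
  mul_eig_le_one : ∀ n, 1 ≤ n → ∀ᵐ ω ∂P, ∀ τ, ∀ j : Fin n,
    α n (sample X n ω) τ * empEig H (sample X n ω) j ≤ 1
  /-- `η_t` diverges -/
  diverges : ∀ M : ℝ, Tendsto (fun p : ℕ × ℕ => P {ω | M ≤ etaR X α p.1 p.2 ω})
    (atTop ×ˢ atTop) (𝓝 1)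
  /-- `η_{t₁} ≪ η_{t₂}` whenever `t₁ ≪ t₂ → ∞` -/
  littleO : ∀ m t₁ t₂ : ℕ → ℕ, Tendsto m atTop atTop → Tendsto t₂ atTop atTop →
    (fun k => (t₁ k : ℝ)) =o[atTop] (fun k => (t₂ k : ℝ)) → ∀ δ : ℝ, 0 < δ →
    Tendsto (fun k => P {ω | etaR X α (m k) (t₁ k) ω ≤ δ * etaR X α (m k) (t₂ k) ω})
      atTop (𝓝 1)

/-- `κ_t` diverges (in probability, if the step sizes depend on the design). -/
def KappaDiverges {Ω 𝒳 : Type*} [MeasurableSpace Ω]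
    (P : Measure Ω) (X : ℕ → Ω → 𝒳) (α : StepRule 𝒳) (μ : ℕ → ℝ) : Prop :=
  ∀ M : ℕ, Tendsto (fun p : ℕ × ℕ => P {ω | M ≤ kappa μ (etaR X α p.1 p.2 ω)})
    (atTop ×ˢ atTop) (𝓝 1)

/-! ### The statistic under the null hypothesis -/

section Null

variable {Ω 𝒳 : Type*} (H : Type*) [NormedAddCommGroup H] [InnerProductSpace ℝ H]
  [CompleteSpace H] [RKHS ℝ H 𝒳 ℝ]

/-- The statistic `D_{n,t}` for the data `yᵢ = f(xᵢ) + εᵢ` with `f = 0`. -/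
def nullStat (X : ℕ → Ω → 𝒳) (ε : ℕ → Ω → ℝ) (α : StepRule 𝒳) (n t : ℕ) (ω : Ω) : ℝ :=
  waldStat H (α n (sample X n ω)) (sample X n ω)
    (response (0 : H) (sample X n ω) (sample ε n ω)) t

/-- `(D_{n,t} - μ_{n,t}) / σ_{n,t}` under the null hypothesis. -/
def stdStat (v : ℝ) (X : ℕ → Ω → 𝒳) (ε : ℕ → Ω → ℝ) (α : StepRule 𝒳) (n t : ℕ) (ω : Ω) : ℝ :=
  (nullStat H X ε α n t ω - nullMean H v (α n (sample X n ω)) (sample X n ω) t) /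
    √(nullVar H v (α n (sample X n ω)) (sample X n ω) t)

/-- The σ-algebra generated by the design `x₁, …, xₙ`. -/
abbrev designSigma [MeasurableSpace 𝒳] (X : ℕ → Ω → 𝒳) (n : ℕ) : MeasurableSpace Ω :=
  MeasurableSpace.comap (sample X n) inferInstance

end Null

end EarlyStopping

end

noncomputable section

namespace EarlyStopping

/-! In an orthonormal eigenbasis of the empirical kernel matrix, gradient descent acts
coordinatewise: the fitted vector has coordinates `s_i z_i`, where `z` is the rotated response and
`s_i = 1 - ∏ (1 - α_τ λ_i)` (`repr_gdIterate`). Under the null hypothesis `z` is rotated Gaussian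
noise, hence again i.i.d. `N(0, v)`. Given the design, the statistic is therefore the weighted
chi-square sum `n⁻¹ ∑ s_i² z_i²`, and its conditional mean and variance follow from the second and
fourth Gaussian moments.

The weights `s_i²` lie in `[0, 1]`, so no single summand dominates once `∑ s_i⁴` is large.
Lindeberg's theorem then holds uniformly over all `n` and all such weights (`exists_weighted_clt`,
`exists_waldStat_clt`), and only `∑ s_i⁴ → ∞` in probability remains.

For this, fix `m`. If `m ≤ κ_t`, the first `m` population eigenvalues are at least `1/η_t`. By the
law of large numbers the empirical Gram matrix of the first `m` eigenfunctions is near the identity,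
so the truncated Mercer expansion forces at least `m` empirical eigenvalues to be at least
`1/(2η_t)`. Each of these has `s_i ≥ 1 - e^{-1/2}`, whence `∑ s_i⁴ ≥ m (1 - e^{-1/2})⁴`
(`IsMercerSystem.le_sum_smoothEig_pow_four`). Since `m` is fixed while `n` and `t` grow, no relation
between `n` and `t` is needed. The unconditional limit follows from the conditional one by the tower
property and bounded convergence. -/

/-! ### Gaussian moments, rotation invariance and weighted sums of squares -/

/-- The moment is the fourth derivative at `0` of the moment generating function. Differentiating
`p(t) e^{vt²/2}` replaces `p` by `p' + v t p`, so only polynomial factors have to be tracked. -/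
theorem integral_pow_four_gaussianReal (v : NNReal) :
    ∫ x, x ^ 4 ∂(gaussianReal 0 v) = 3 * (v : ℝ) ^ 2 := by
  have h := iteratedDeriv_mgf_zero (X := id) (μ := gaussianReal 0 v)
    (by rw [integrableExpSet_id_gaussianReal]; simp) 4
  have d (p q : ℝ → ℝ) (hp : ∀ t, HasDerivAt p (q t) t) :
      deriv (fun t => p t * Real.exp (v * t ^ 2 / 2)) =
        fun t => (q t + p t * (v * t)) * Real.exp (v * t ^ 2 / 2) := by
    funext t
    have h2 : HasDerivAt (fun t : ℝ => (v : ℝ) * t ^ 2 / 2) (v * t) t := by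
      have := ((hasDerivAt_pow 2 t).const_mul (v : ℝ)).div_const 2
      convert! this using 1
      simp; ring
    rw [((hp t).fun_mul h2.exp).deriv]
    ring
  have e : mgf id (gaussianReal 0 v) = fun t => 1 * Real.exp (v * t ^ 2 / 2) := by
    rw [mgf_id_gaussianReal]; simp
  rw [e, iteratedDeriv_eq_iterate] at h
  simp only [Function.iterate_succ, Function.iterate_zero, Function.comp_apply, id] at h
  rw [d (fun _ => 1) (fun _ => 0) (fun t => hasDerivAt_const t 1),
    d (fun t => 0 + 1 * (v * t)) (fun _ => v)
      (fun t => by simpa using (hasDerivAt_id t).const_mul (v : ℝ)),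
    d (fun t => v + (0 + 1 * (v * t)) * (v * t)) (fun t => 2 * v ^ 2 * t) (fun t => by
      have := ((hasDerivAt_pow 2 t).const_mul ((v : ℝ) ^ 2)).const_add (v : ℝ)
      convert! this using 1
      · funext s; simp; ring
      · simp; ring),
    d (fun t => 2 * v ^ 2 * t + (v + (0 + 1 * (v * t)) * (v * t)) * (v * t))
      (fun t => 3 * v ^ 2 + 3 * v ^ 3 * t ^ 2) (fun t => by
      have := ((hasDerivAt_id t).const_mul (3 * (v : ℝ) ^ 2)).add
        ((hasDerivAt_pow 3 t).const_mul ((v : ℝ) ^ 3))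
      convert! this using 1
      · funext s; simp; ring
      · simp; ring)] at h
  simp at h
  rw [← h]

theorem integral_pow_two_gaussianReal (v : NNReal) :
    ∫ x, x ^ 2 ∂(gaussianReal 0 v) = v := by
  have h := variance_fun_id_gaussianReal (μ := 0) (v := v)
  rw [variance_eq_integral (by fun_prop), integral_id_gaussianReal] at h
  simpa using h

theorem memLp_sq_gaussianReal (v : NNReal) :
    MemLp (fun x : ℝ => x ^ 2) 2 (gaussianReal 0 v) := by
  rw [memLp_two_iff_integrable_sq (by fun_prop)]
  have := (memLp_id_gaussianReal (μ := 0) (v := v) 4).integrable_norm_pow (by norm_num)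
  refine (integrable_congr ?_).mp this
  filter_upwards with x
  simp only [id, Real.norm_eq_abs]
  have := abs_pow x 4
  rw [← this, abs_of_nonneg (by positivity)]; ring

theorem variance_sq_gaussianReal (v : NNReal) :
    Var[fun x : ℝ => x ^ 2; gaussianReal 0 v] = 2 * (v : ℝ) ^ 2 := by
  rw [variance_eq_sub (memLp_sq_gaussianReal v)]
  have : ((fun x : ℝ => x ^ 2) ^ 2) = fun x => x ^ 4 := by funext x; simp; ring
  rw [this, integral_pow_four_gaussianReal, integral_pow_two_gaussianReal]
  ring

/-- The product of equal centred Gaussian laws is invariant under orthogonal maps. -/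
theorem measurePreserving_repr_pi_gaussianReal {ι : Type*} [Fintype ι] (v : NNReal)
    (b : OrthonormalBasis ι ℝ (EuclideanSpace ℝ ι)) :
    MeasurePreserving (fun e : ι → ℝ => (b.repr (WithLp.toLp 2 e)).ofLp)
      (Measure.pi fun _ => gaussianReal 0 v) (Measure.pi fun _ => gaussianReal 0 v) := by
  set ν : Measure (ι → ℝ) := Measure.pi fun _ => gaussianReal 0 v with hν
  -- The characteristic function depends on `t` only through `‖t‖`, which the inverse isometry
  -- preserves.
  have hc (t : EuclideanSpace ℝ ι) : charFun (ν.map (WithLp.toLp 2)) t =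
      Complex.exp ((-(v * ‖t‖ ^ 2 / 2) : ℝ)) := by
    rw [hν, charFun_pi]
    simp_rw [charFun_gaussianReal, ← Complex.exp_sum, EuclideanSpace.real_norm_sq_eq]
    congr 1
    push_cast
    simp [Finset.mul_sum, Finset.sum_div]
  have hm : (ν.map (WithLp.toLp 2)).map b.repr = ν.map (WithLp.toLp 2) := by
    apply Measure.ext_of_charFun
    ext t
    have : charFun ((ν.map (WithLp.toLp 2)).map b.repr) t =
        charFun (ν.map (WithLp.toLp 2)) (b.repr.symm t) := by
      rw [charFun_apply, charFun_apply, integral_map (by fun_prop) (by fun_prop)]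
      congr 1; funext x
      rw [← b.repr.symm.inner_map_map]; simp
    rw [this, hc, hc, LinearIsometryEquiv.norm_map]
  refine ⟨by fun_prop, ?_⟩
  have := congrArg (Measure.map (WithLp.ofLp (p := 2) (V := ι → ℝ))) hm
  rw [Measure.map_map (by fun_prop) (by fun_prop), Measure.map_map (by fun_prop) (by fun_prop),
    Measure.map_map (by fun_prop) (by fun_prop)] at this
  exact this.trans (by simp [Function.comp_def])

section QuadraticForm

variable {n : ℕ} (v : NNReal) (a : Fin n → ℝ)

theorem memLp_weighted_sq_sum :
    MemLp (fun z : Fin n → ℝ => ∑ j, a j * z j ^ 2) 2 (Measure.pi fun _ => gaussianReal 0 v) :=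
  memLp_finsetSum _ fun j _ => ((memLp_sq_gaussianReal v).comp_measurePreserving
    (measurePreserving_eval (fun _ : Fin n => gaussianReal 0 v) j)).const_mul (a j)

theorem integral_weighted_sq_sum :
    ∫ z : Fin n → ℝ, ∑ j, a j * z j ^ 2 ∂(Measure.pi fun _ => gaussianReal 0 v) = v * ∑ j, a j := by
  rw [integral_finsetSum]
  · simp_rw [integral_const_mul]
    rw [Finset.mul_sum]
    refine Finset.sum_congr rfl fun j _ => ?_
    rw [integral_comp_eval (μ := fun _ : Fin n => gaussianReal 0 v) (f := fun x : ℝ => x ^ 2)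
      (by fun_prop), integral_pow_two_gaussianReal, mul_comm]
  · intro j _
    exact (((memLp_sq_gaussianReal v).comp_measurePreserving
      (measurePreserving_eval (fun _ : Fin n => gaussianReal 0 v) j)).const_mul (a j)).integrable
      one_le_two

theorem variance_weighted_sq_sum :
    Var[fun z : Fin n → ℝ => ∑ j, a j * z j ^ 2; Measure.pi fun _ => gaussianReal 0 v] =
      2 * (v : ℝ) ^ 2 * ∑ j, a j ^ 2 := by
  have h := variance_sum_pi (μ := fun _ : Fin n => gaussianReal 0 v)
    (X := fun j x => a j * x ^ 2) (fun j => (memLp_sq_gaussianReal v).const_mul (a j))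
  have e : (∑ i, fun ω : Fin n → ℝ => (fun j x => a j * x ^ 2) i (ω i)) =
      fun z : Fin n → ℝ => ∑ j, a j * z j ^ 2 := by
    funext z; simp
  rw [e] at h
  rw [h, Finset.mul_sum]
  refine Finset.sum_congr rfl fun j _ => ?_
  rw [variance_const_mul, variance_sq_gaussianReal]; ring

end QuadraticForm

/-! ### Conditioning on one of two independent variables -/

/-- Conditional expectation of a function of two independent variables given one of them. -/
theorem condExp_prod_of_indepFun {Ω E F : Type*} [MeasurableSpace Ω] [mE : MeasurableSpace E]
    [MeasurableSpace F] {P : Measure Ω} [IsProbabilityMeasure P] {U : Ω → E} {V : Ω → F}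
    (hU : Measurable U) (hV : Measurable V) (hUV : IndepFun U V P) {G : E × F → ℝ}
    (hG : Measurable G) (hint : Integrable (fun ω => G (U ω, V ω)) P) :
    P[fun ω => G (U ω, V ω) | mE.comap U] =ᵐ[P] fun ω => ∫ y, G (U ω, y) ∂(P.map V) := by
  have hmap := (indepFun_iff_map_prod_eq_prod_map_map hU.aemeasurable hV.aemeasurable).1 hUV
  have := Measure.isProbabilityMeasure_map (μ := P) hU.aemeasurable
  have := Measure.isProbabilityMeasure_map (μ := P) hV.aemeasurable
  have hint' : Integrable G ((P.map U).prod (P.map V)) := by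
    rw [← hmap, integrable_map_measure hG.aestronglyMeasurable (hU.prodMk hV).aemeasurable]
    exact hint
  have hsm : StronglyMeasurable fun x => ∫ y, G (x, y) ∂(P.map V) :=
    hG.stronglyMeasurable.integral_prod_right'
  have hintI : Integrable (fun ω => ∫ y, G (U ω, y) ∂(P.map V)) P :=
    (integrable_map_measure hsm.aestronglyMeasurable hU.aemeasurable).1 hint'.integral_prod_left
  refine (ae_eq_condExp_of_forall_setIntegral_eq hU.comap_le hint
    (fun s _ _ => hintI.integrableOn) ?_ ?_).symm
  · rintro s ⟨t, ht, rfl⟩ -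
    have h1 : ∫ ω in U ⁻¹' t, (∫ y, G (U ω, y) ∂(P.map V)) ∂P =
        ∫ x in t, (∫ y, G (x, y) ∂(P.map V)) ∂(P.map U) :=
      (setIntegral_map ht hsm.aestronglyMeasurable hU.aemeasurable).symm
    have h2 : ∫ ω in U ⁻¹' t, G (U ω, V ω) ∂P =
        ∫ p in t ×ˢ Set.univ, G p ∂((P.map U).prod (P.map V)) := by
      rw [← hmap, setIntegral_map (ht.prod MeasurableSet.univ) hG.aestronglyMeasurable
        (hU.prodMk hV).aemeasurable]
      simp [Set.mk_preimage_prod]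
    rw [h1, h2, setIntegral_prod _ hint'.integrableOn]
    simp
  · exact (hsm.comp_measurable (Measurable.of_comap_le le_rfl)).aestronglyMeasurable

/-! ### A Lindeberg theorem uniform in the weights -/

/-- Telescoping: the factors are exchanged one at a time, and the remaining ones have norm at most
`1`. -/
theorem norm_prod_sub_prod_le_sum {ι : Type*} (s : Finset ι) (z w : ι → ℂ)
    (hz : ∀ i ∈ s, ‖z i‖ ≤ 1) (hw : ∀ i ∈ s, ‖w i‖ ≤ 1) :
    ‖∏ i ∈ s, z i - ∏ i ∈ s, w i‖ ≤ ∑ i ∈ s, ‖z i - w i‖ := by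
  classical
  induction s using Finset.induction with
  | empty => simp
  | insert i s hi ih =>
    have hz' : ∀ j ∈ s, ‖z j‖ ≤ 1 := fun j hj => hz j (Finset.mem_insert_of_mem hj)
    have hw' : ∀ j ∈ s, ‖w j‖ ≤ 1 := fun j hj => hw j (Finset.mem_insert_of_mem hj)
    rw [Finset.prod_insert hi, Finset.prod_insert hi, Finset.sum_insert hi]
    have h1 : ‖∏ j ∈ s, z j‖ ≤ 1 := by
      rw [norm_prod]; exact Finset.prod_le_one (fun _ _ => norm_nonneg _) hz'
    have e : z i * ∏ j ∈ s, z j - w i * ∏ j ∈ s, w j =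
        (z i - w i) * ∏ j ∈ s, z j + w i * (∏ j ∈ s, z j - ∏ j ∈ s, w j) := by ring
    rw [e]
    refine (norm_add_le _ _).trans (add_le_add ?_ ?_)
    · rw [norm_mul]; exact mul_le_of_le_one_right (norm_nonneg _) h1
    · rw [norm_mul]
      exact (mul_le_of_le_one_left (norm_nonneg _) (hw i (Finset.mem_insert_self _ _))).trans
        (ih hz' hw')

/-- Second order expansion of the characteristic function of a standardized law, in the form
used in the Lindeberg argument. -/
theorem exists_charFun_sub_exp_le (ρ : Measure ℝ) [IsProbabilityMeasure ρ]
    (h0 : ∫ x, x ∂ρ = 0) (h1 : ∫ x, x ^ 2 ∂ρ = 1) {δ : ℝ} (hδ : 0 < δ) :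
    ∃ r > 0, ∀ s : ℝ, |s| ≤ r →
      ‖charFun ρ s - Complex.exp ((-(s ^ 2 / 2) : ℝ))‖ ≤ δ * s ^ 2 := by
  -- `ρ` and `N(0, 1)` share their first two moments, so their Taylor polynomials cancel and the
  -- difference is `o(s²)`.
  have k1 := taylor_charFun_two (P := ρ) (X := id) aemeasurable_id (by simpa using h0)
    (by simpa using h1)
  have k2 := taylor_charFun_two (P := gaussianReal 0 1) (X := id) aemeasurable_id
    (by simp) (by simpa using integral_pow_two_gaussianReal 1)
  rw [Measure.map_id] at k1 k2
  have k := (k1.sub k2).bound hδ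
  obtain ⟨r, hr, h⟩ := Metric.eventually_nhds_iff_ball.1 k
  refine ⟨r / 2, by positivity, fun s hs => ?_⟩
  have := h s (by rw [mem_ball_zero_iff, Real.norm_eq_abs]; linarith)
  rw [charFun_gaussianReal] at this
  simp only [sub_sub_sub_cancel_right, Real.norm_eq_abs] at this
  rw [abs_of_nonneg (sq_nonneg s)] at this
  convert! this using 4
  push_cast; simp

/-- Lindeberg's theorem for weighted sums with weights bounded by `1`, uniformly over the
weights. -/
theorem exists_weighted_clt (ρ : Measure ℝ) [IsProbabilityMeasure ρ]
    (h0 : ∫ x, x ∂ρ = 0) (h1 : ∫ x, x ^ 2 ∂ρ = 1) (g : BoundedContinuousFunction ℝ ℝ)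
    {δ : ℝ} (hδ : 0 < δ) :
    ∃ B : ℝ, 0 < B ∧ ∀ (n : ℕ) (a : Fin n → ℝ), (∀ j, |a j| ≤ 1) → B ≤ ∑ j, a j ^ 2 →
      |∫ w : Fin n → ℝ, g ((∑ j, a j * w j) / √(∑ j, a j ^ 2)) ∂(Measure.pi fun _ => ρ) -
        ∫ z, g z ∂(gaussianReal 0 1)| ≤ δ := by
  -- Uniformity by contradiction: a counterexample for every threshold `k + 1` yields a sequence of
  -- weight vectors with `∑ a_j² → ∞`, along which ordinary weak convergence is enough.
  by_contra! hcon
  choose n a ha hB hlt using fun k : ℕ => hcon (k + 1) (by positivity)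
  set q : (k : ℕ) → ℝ := fun k => √(∑ j, a k j ^ 2) with hq
  have hqpos (k) : 0 < q k := Real.sqrt_pos.2 (lt_of_lt_of_le (by positivity) (hB k))
  have hqsq (k) : q k ^ 2 = ∑ j, a k j ^ 2 :=
    Real.sq_sqrt (Finset.sum_nonneg fun _ _ => sq_nonneg _)
  let T (k : ℕ) : (Fin (n k) → ℝ) → ℝ := fun w => (∑ j, a k j * w j) / q k
  have hT (k) : Measurable (T k) := by fun_prop
  let ν (k : ℕ) : ProbabilityMeasure ℝ :=
    ⟨(Measure.pi fun _ => ρ).map (T k), Measure.isProbabilityMeasure_map (hT k).aemeasurable⟩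
  let γ : ProbabilityMeasure ℝ := ⟨gaussianReal 0 1, inferInstance⟩
  have hν : Tendsto ν atTop (𝓝 γ) := by
    refine ProbabilityMeasure.tendsto_iff_tendsto_charFun.2 fun t => ?_
    have hcf (k) : charFun (ν k : Measure ℝ) t = ∏ j, charFun ρ (a k j / q k * t) := by
      have hT' : T k = fun w => ∑ j, (a k j / q k) * w j := by
        funext w; simp only [T, Finset.sum_div]
        exact Finset.sum_congr rfl fun j _ => by ring
      simp only [ν, ProbabilityMeasure.coe_mk]
      have hm (j : Fin (n k)) :
          AEMeasurable (fun ω : Fin (n k) → ℝ => a k j / q k * ω j) (Measure.pi fun _ => ρ) :=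
        (measurable_const.mul (measurable_pi_apply j)).aemeasurable
      rw [hT', (iIndepFun_pi (μ := fun _ : Fin (n k) => ρ) (X := fun j x => a k j / q k * x)
        (fun j => by fun_prop)).charFun_map_fun_sum_eq_prod hm]
      rw [Finset.prod_apply]
      refine Finset.prod_congr rfl fun j _ => ?_
      have : (fun ω : Fin (n k) → ℝ => a k j / q k * ω j) =
        (fun x => a k j / q k * x) ∘ (fun ω => ω j) := rfl
      rw [this, ← Measure.map_map (by fun_prop) (by fun_prop),
        (measurePreserving_eval (fun _ => ρ) j).map_eq, charFun_map_mul]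
    have hg : charFun (γ : Measure ℝ) t =
        Complex.exp ((-(t ^ 2 / 2) : ℝ)) := by
      simp [γ, charFun_gaussianReal]
    -- The normalized weights have squares summing to `1`, so the Gaussian characteristic function
    -- factors along them and can be compared factor by factor.
    have hprod (k) : Complex.exp ((-(t ^ 2 / 2) : ℝ)) =
        ∏ j, Complex.exp ((-((a k j / q k * t) ^ 2 / 2) : ℝ)) := by
      rw [← Complex.exp_sum, ← Complex.ofReal_sum]
      congr 2
      have : ∑ j, (a k j / q k) ^ 2 = 1 := by
        simp_rw [div_pow]
        rw [← Finset.sum_div, hqsq, div_self]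
        rw [← hqsq]; have := hqpos k; positivity
      simp_rw [mul_pow]
      rw [Finset.sum_neg_distrib, ← Finset.sum_div, ← Finset.sum_mul, this, one_mul]
    simp_rw [hcf, hg]
    rw [Metric.tendsto_atTop]
    intro η hη
    -- With this constant the errors sum to `η t² / (2(t² + 1)) < η`. The bound `N ≥ (|t|/r)²` keeps
    -- every argument `a_j t / q_k` within radius `r`, because `|a_j| ≤ 1` and `q_k² ≥ k + 1`.
    obtain ⟨r, hr, hbd⟩ := exists_charFun_sub_exp_le ρ h0 h1
      (δ := η / (2 * (t ^ 2 + 1))) (by positivity)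
    obtain ⟨N, hN⟩ := exists_nat_ge ((|t| / r) ^ 2)
    refine ⟨N, fun k hk => ?_⟩
    rw [dist_eq_norm, hprod k]
    refine (norm_prod_sub_prod_le_sum _ _ _ (fun j _ => norm_charFun_le_one _)
      (fun j _ => ?_)).trans_lt ?_
    · rw [Complex.norm_exp_ofReal, Real.exp_le_one_iff]
      have := sq_nonneg (a k j / q k * t)
      linarith
    have hsmall (j) : |a k j / q k * t| ≤ r := by
      have hq1 : |t| / r ≤ q k := by
        apply Real.le_sqrt_of_sq_le
        have : (N : ℝ) ≤ k := by exact_mod_cast hk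
        linarith [hB k]
      rw [abs_mul, abs_div, abs_of_pos (hqpos k), div_mul_eq_mul_div, div_le_iff₀ (hqpos k)]
      rw [div_le_iff₀ hr] at hq1
      nlinarith [ha k j, abs_nonneg t, abs_nonneg (a k j)]
    calc _ ≤ ∑ j, η / (2 * (t ^ 2 + 1)) * (a k j / q k * t) ^ 2 :=
          Finset.sum_le_sum fun j _ => hbd _ (hsmall j)
      _ = η / (2 * (t ^ 2 + 1)) * t ^ 2 := by
          rw [← Finset.mul_sum]
          congr 1
          simp_rw [mul_pow, div_pow]
          rw [← Finset.sum_mul, ← Finset.sum_div, hqsq, div_self, one_mul]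
          rw [← hqsq]; have := hqpos k; positivity
      _ < η := by
          rw [div_mul_eq_mul_div, div_lt_iff₀ (by positivity)]
          nlinarith [sq_nonneg t]
  have hlim := (ProbabilityMeasure.tendsto_iff_forall_integral_tendsto.1 hν) g
  rw [Metric.tendsto_atTop] at hlim
  obtain ⟨N, hN⟩ := hlim δ hδ
  have h2 := hN N le_rfl
  rw [Real.dist_eq] at h2
  have h3 : ∫ x, g x ∂(ν N : Measure ℝ) =
      ∫ w : Fin (n N) → ℝ, g ((∑ j, a N j * w j) / q N) ∂(Measure.pi fun _ => ρ) :=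
    integral_map (hT N).aemeasurable g.continuous.aestronglyMeasurable
  rw [h3] at h2
  exact absurd (hlt N) (not_lt.2 h2.le)

/-! ### Counting large eigenvalues of a symmetric matrix -/

section Spectral

variable {n : ℕ} {A : Matrix (Fin n) (Fin n) ℝ} (hA : A.IsHermitian)

theorem eigenvectorBasis_repr_mulVec (w : Fin n → ℝ) (i : Fin n) :
    hA.eigenvectorBasis.repr (WithLp.toLp 2 (A.mulVec w)) i =
      hA.eigenvalues i * hA.eigenvectorBasis.repr (WithLp.toLp 2 w) i := by
  have hT : A.transpose = A := by simpa [Matrix.IsHermitian] using hA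
  rw [OrthonormalBasis.repr_apply_apply, OrthonormalBasis.repr_apply_apply,
    EuclideanSpace.inner_eq_star_dotProduct, EuclideanSpace.inner_eq_star_dotProduct]
  simp only [star_trivial]
  rw [dotProduct_comm, Matrix.dotProduct_mulVec, ← Matrix.mulVec_transpose, hT,
    hA.mulVec_eigenvectorBasis, smul_dotProduct, dotProduct_comm, smul_eq_mul]

theorem sum_eigenvectorBasis_repr_sq (w : Fin n → ℝ) :
    ∑ i, hA.eigenvectorBasis.repr (WithLp.toLp 2 w) i ^ 2 = ∑ i, w i ^ 2 := by
  have h := hA.eigenvectorBasis.repr.norm_map (WithLp.toLp 2 w)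
  rw [← sq_eq_sq₀ (norm_nonneg _) (norm_nonneg _), EuclideanSpace.real_norm_sq_eq,
    EuclideanSpace.real_norm_sq_eq] at h
  exact h

theorem dotProduct_mulVec_eq_sum_eigenvalues (w : Fin n → ℝ) :
    w ⬝ᵥ A.mulVec w =
      ∑ i, hA.eigenvalues i * hA.eigenvectorBasis.repr (WithLp.toLp 2 w) i ^ 2 := by
  have h := hA.eigenvectorBasis.repr.inner_map_map (WithLp.toLp 2 (A.mulVec w)) (WithLp.toLp 2 w)
  rw [EuclideanSpace.inner_eq_star_dotProduct, EuclideanSpace.inner_eq_star_dotProduct] at h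
  simp only [star_trivial] at h
  rw [← h, dotProduct]
  refine Finset.sum_congr rfl fun i _ => ?_
  rw [eigenvectorBasis_repr_mulVec hA]; ring

/-- If the quadratic form of `A` is at least `δ‖·‖²` on an injective image of `ℝᵐ`, then at least
`m` eigenvalues of `A` are at least `δ`. -/
theorem card_eigenvalues_ge {m : ℕ} (L : (Fin m → ℝ) →ₗ[ℝ] (Fin n → ℝ)) (δ : ℝ)
    (hL : ∀ u, L u = 0 → u = 0) (hq : ∀ u, δ * (L u ⬝ᵥ L u) ≤ L u ⬝ᵥ A.mulVec (L u)) :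
    m ≤ (Finset.univ.filter fun i => δ ≤ hA.eigenvalues i).card := by
  by_contra! hlt
  set s := Finset.univ.filter fun i => δ ≤ hA.eigenvalues i
  -- `R u` lists the coordinates of `L u` along eigenvectors with eigenvalue at least `δ`. With
  -- fewer than `m` of them, some `u ≠ 0` has `L u` in the span of the other eigenvectors, where the
  -- form is strictly below `δ‖·‖²` off zero.
  let R : (Fin m → ℝ) →ₗ[ℝ] (s → ℝ) := LinearMap.pi fun i =>
    (LinearMap.proj (i : Fin n)) ∘ₗ (WithLp.linearEquiv 2 ℝ (Fin n → ℝ)).toLinearMap ∘ₗ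
      hA.eigenvectorBasis.repr.toLinearEquiv.toLinearMap ∘ₗ
      (WithLp.linearEquiv 2 ℝ (Fin n → ℝ)).symm.toLinearMap ∘ₗ L
  have hR (u) (i : s) : R u i = hA.eigenvectorBasis.repr (WithLp.toLp 2 (L u)) i := rfl
  obtain ⟨u, hu, hu0⟩ := (Submodule.ne_bot_iff _).1
    (LinearMap.ker_ne_bot_of_finrank_lt (f := R) (by simpa using hlt))
  apply hu0
  apply hL
  have hc : ∀ i ∈ s, hA.eigenvectorBasis.repr (WithLp.toLp 2 (L u)) i = 0 := fun i hi => by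
    rw [← hR u ⟨i, hi⟩, LinearMap.mem_ker.1 hu]; rfl
  have h := hq u
  rw [dotProduct_mulVec_eq_sum_eigenvalues hA] at h
  have e : L u ⬝ᵥ L u = ∑ i, hA.eigenvectorBasis.repr (WithLp.toLp 2 (L u)) i ^ 2 := by
    rw [sum_eigenvectorBasis_repr_sq]; simp [dotProduct, sq]
  rw [e, Finset.mul_sum, ← sub_nonpos, ← Finset.sum_sub_distrib] at h
  have hnn : ∀ i ∈ Finset.univ, 0 ≤ δ * hA.eigenvectorBasis.repr (WithLp.toLp 2 (L u)) i ^ 2 -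
      hA.eigenvalues i * hA.eigenvectorBasis.repr (WithLp.toLp 2 (L u)) i ^ 2 := by
    intro i _
    by_cases hi : i ∈ s
    · simp [hc i hi]
    · have : hA.eigenvalues i < δ := by simpa [s] using hi
      rw [← sub_mul]; exact mul_nonneg (by linarith) (sq_nonneg _)
  have hz := (Finset.sum_eq_zero_iff_of_nonneg hnn).1 (le_antisymm h (Finset.sum_nonneg hnn))
  have hall : ∀ i, hA.eigenvectorBasis.repr (WithLp.toLp 2 (L u)) i = 0 := by
    intro i
    by_cases hi : i ∈ s
    · exact hc i hi
    · have hlt' : hA.eigenvalues i < δ := by simpa [s] using hi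
      have := hz i (Finset.mem_univ _)
      rw [← sub_mul] at this
      rcases mul_eq_zero.1 this with h' | h'
      · linarith
      · exact pow_eq_zero_iff (two_ne_zero) |>.1 h'
  have hsum : ∑ i, (L u) i ^ 2 = 0 := by
    rw [← sum_eigenvectorBasis_repr_sq hA]; simp [hall]
  funext i
  have := (Finset.sum_eq_zero_iff_of_nonneg (fun i _ => sq_nonneg (L u i))).1 hsum i
    (Finset.mem_univ _)
  simpa using this

end Spectral

/-! ### Gradient descent in the eigenbasis of the empirical kernel -/

/-- `∏_{τ < t} (1 - α_τ l)`: the factor by which `t` descent steps shrink the residual along an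
eigenvector with eigenvalue `l`. -/
def shrinkFactor (α : ℕ → ℝ) (t : ℕ) (l : ℝ) : ℝ := ∏ τ ∈ Finset.range t, (1 - α τ * l)

theorem shrinkFactor_succ (α : ℕ → ℝ) (t : ℕ) (l : ℝ) :
    shrinkFactor α (t + 1) l = shrinkFactor α t l * (1 - α t * l) :=
  Finset.prod_range_succ _ _

theorem shrinkFactor_nonneg {α : ℕ → ℝ} {l : ℝ} (h1 : ∀ τ, α τ * l ≤ 1) (t : ℕ) :
    0 ≤ shrinkFactor α t l :=
  Finset.prod_nonneg fun τ _ => sub_nonneg.2 (h1 τ)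

/-- From `1 - x ≤ e^{-x}` in each factor; the step size bound makes the factors nonnegative, so the
inequalities multiply. -/
theorem shrinkFactor_le_exp {α : ℕ → ℝ} {l : ℝ} (h1 : ∀ τ, α τ * l ≤ 1) (t : ℕ) :
    shrinkFactor α t l ≤ Real.exp (-(totalStep α t * l)) := by
  rw [totalStep, Finset.sum_mul, ← Finset.sum_neg_distrib, Real.exp_sum]
  exact Finset.prod_le_prod (fun τ _ => sub_nonneg.2 (h1 τ)) fun τ _ => by
    have := Real.add_one_le_exp (-(α τ * l)); linarith

section Kernel

variable {𝒳 : Type*} (H : Type*) [NormedAddCommGroup H] [InnerProductSpace ℝ H]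
  [CompleteSpace H] [RKHS ℝ H 𝒳 ℝ] {n : ℕ} (x : Fin n → 𝒳)

/-- The sorted eigenvalues are a relabelling of those paired with `eigenvectorBasis`. Traces do not
see the order, so the proof can work with the latter. -/
theorem empEig_eq_eigenvalues :
    ∃ σ : Fin n ≃ Fin n, ∀ j, empEig H x j = (empKernel_isHermitian H x).eigenvalues (σ j) := by
  refine ⟨(finCongr (Fintype.card_fin n).symm).trans
    (Fintype.equivOfCardEq (Fintype.card_fin _)), fun j => ?_⟩
  simp [empEig, Matrix.IsHermitian.eigenvalues]

theorem shrink_eq_diagonal (α : ℕ → ℝ) (t : ℕ) :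
    shrink H α x t = Matrix.diagonal fun j => shrinkFactor α t (empEig H x j) := by
  induction t with
  | zero => simp [shrink, shrinkFactor]
  | succ t ih =>
    rw [shrink, ih, ← Matrix.diagonal_one, ← Matrix.diagonal_smul, Matrix.diagonal_sub,
      Matrix.diagonal_mul_diagonal]
    congr 1
    funext j
    simp [shrinkFactor_succ]

/-- The spectrum `1 - ∏_{τ < t} (1 - α_τ λ_i)` of the smoothing operator. -/
def smoothEig (α : ℕ → ℝ) (t : ℕ) (i : Fin n) : ℝ :=
  1 - shrinkFactor α t ((empKernel_isHermitian H x).eigenvalues i)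

theorem trace_one_sub_shrink_pow (α : ℕ → ℝ) (t k : ℕ) :
    ((1 - shrink H α x t) ^ k).trace = ∑ i, smoothEig H x α t i ^ k := by
  obtain ⟨σ, hσ⟩ := empEig_eq_eigenvalues H x
  rw [shrink_eq_diagonal, ← Matrix.diagonal_one, Matrix.diagonal_sub, Matrix.diagonal_pow,
    Matrix.trace_diagonal, ← Equiv.sum_comp σ fun i => smoothEig H x α t i ^ k]
  simp [smoothEig, hσ]

theorem dotProduct_empKernel (w : Fin n → ℝ) :
    w ⬝ᵥ (empKernel H x).mulVec w =
      (1 / (n : ℝ)) * ∑ i, ∑ j, w i * w j * kern H (x i) (x j) := by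
  simp only [dotProduct, Matrix.mulVec, empKernel, Matrix.of_apply, Finset.mul_sum]
  exact Finset.sum_congr rfl fun i _ => Finset.sum_congr rfl fun j _ => by ring

variable {H} in
theorem kerFun_apply_eq_kern (z z' : 𝒳) : RKHS.kerFun H z (1 : ℝ) z' = kern H z' z := by
  rw [RKHS.kerFun_apply]; rfl

/-- Up to the factor `1/n`, the quadratic form at `w` is the squared norm of `∑ w_i K(x_i, ·)` in
`H`. -/
theorem eigenvalues_empKernel_nonneg (i : Fin n) :
    0 ≤ (empKernel_isHermitian H x).eigenvalues i := by
  have h (w : Fin n → ℝ) : 0 ≤ w ⬝ᵥ (empKernel H x).mulVec w := by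
    rw [dotProduct_empKernel]
    refine mul_nonneg (by positivity) ?_
    have : ∑ i, ∑ j, w i * w j * kern H (x i) (x j) =
        inner ℝ (∑ i, w i • RKHS.kerFun H (x i) (1 : ℝ)) (∑ i, w i • RKHS.kerFun H (x i) 1) := by
      simp only [sum_inner, inner_sum, real_inner_smul_left, real_inner_smul_right]
      refine Finset.sum_congr rfl fun i _ => Finset.sum_congr rfl fun j _ => ?_
      rw [RKHS.kerFun_inner, kerFun_apply_eq_kern]
      rw [kern_symm]; simp; ring
    rw [this]; exact real_inner_self_nonneg
  rw [(empKernel_isHermitian H x).eigenvalues_eq]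
  simpa using h _

theorem smoothEig_mem_Icc {α : ℕ → ℝ} (h0 : ∀ τ, 0 ≤ α τ)
    (h1 : ∀ τ j, α τ * empEig H x j ≤ 1) (t : ℕ) (i : Fin n) :
    smoothEig H x α t i ∈ Set.Icc (0 : ℝ) 1 := by
  obtain ⟨σ, hσ⟩ := empEig_eq_eigenvalues H x
  have h1' : ∀ τ, α τ * (empKernel_isHermitian H x).eigenvalues i ≤ 1 := fun τ => by
    have := h1 τ (σ.symm i); rwa [hσ, σ.apply_symm_apply] at this
  have hl := eigenvalues_empKernel_nonneg H x i
  have hη : 0 ≤ totalStep α t := Finset.sum_nonneg fun τ _ => h0 τ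
  have ha := shrinkFactor_nonneg h1' t
  have hb := (shrinkFactor_le_exp h1' t).trans (Real.exp_le_one_iff.2
    (neg_nonpos.2 (mul_nonneg hη hl)))
  constructor <;> simp only [smoothEig] <;> linarith

theorem smoothEig_ge {α : ℕ → ℝ} (h1 : ∀ τ j, α τ * empEig H x j ≤ 1) (t : ℕ) (i : Fin n) :
    1 - Real.exp (-(totalStep α t * (empKernel_isHermitian H x).eigenvalues i)) ≤
      smoothEig H x α t i := by
  obtain ⟨σ, hσ⟩ := empEig_eq_eigenvalues H x
  have h1' : ∀ τ, α τ * (empKernel_isHermitian H x).eigenvalues i ≤ 1 := fun τ => by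
    have := h1 τ (σ.symm i); rwa [hσ, σ.apply_symm_apply] at this
  have := shrinkFactor_le_exp h1' t
  simp only [smoothEig]; linarith

theorem gdIterate_succ_apply (α : ℕ → ℝ) (y : Fin n → ℝ) (t : ℕ) (z : 𝒳) :
    gdIterate H α x y (t + 1) z = gdIterate H α x y t z -
      α t * ((1 / (n : ℝ)) * ∑ i, (gdIterate H α x y t (x i) - y i) * kern H z (x i)) := by
  have hsum (c : Fin n → H) : (∑ i, c i) z = ∑ i, c i z := by
    have := congrFun (map_sum (RKHS.coeCLM ℝ (H := H) (X := 𝒳) (V := ℝ)) c Finset.univ) z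
    exact this.trans (by rw [Finset.sum_apply]; rfl)
  rw [gdIterate, lossGrad, RKHS.coe_sub, Pi.sub_apply, RKHS.coe_smul, Pi.smul_apply,
    RKHS.coe_smul, Pi.smul_apply, hsum]
  simp only [RKHS.coe_smul, Pi.smul_apply, smul_eq_mul, kerFun_apply_eq_kern]

/-- At the design points one step subtracts `α_t` times the kernel matrix applied to the residual.
In the eigenbasis this multiplies the `i`-th residual coordinate by `1 - α_t λ_i`, and the initial
residual is `-y`. -/
theorem repr_gdIterate (α : ℕ → ℝ) (y : Fin n → ℝ) (t : ℕ) (i : Fin n) :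
    (empKernel_isHermitian H x).eigenvectorBasis.repr
        (WithLp.toLp 2 fun k => gdIterate H α x y t (x k)) i =
      smoothEig H x α t i * (empKernel_isHermitian H x).eigenvectorBasis.repr
        (WithLp.toLp 2 y) i := by
  induction t with
  | zero =>
    have : (fun k => gdIterate H α x y 0 (x k)) = 0 := by
      funext k; simp [gdIterate]
    rw [this]; simp [smoothEig, shrinkFactor]
  | succ t ih =>
    have : (fun k => gdIterate H α x y (t + 1) (x k)) =
        (fun k => gdIterate H α x y t (x k)) -
          α t • (empKernel H x).mulVec ((fun k => gdIterate H α x y t (x k)) - y) := by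
      funext k
      rw [gdIterate_succ_apply]
      simp only [Pi.sub_apply, Pi.smul_apply, smul_eq_mul, Matrix.mulVec, dotProduct, empKernel,
        Matrix.of_apply, Finset.mul_sum]
      congr 1
      exact Finset.sum_congr rfl fun j _ => by ring
    rw [this, WithLp.toLp_sub, WithLp.toLp_smul, map_sub, map_smul, PiLp.sub_apply,
      PiLp.smul_apply, eigenvectorBasis_repr_mulVec, WithLp.toLp_sub, map_sub, PiLp.sub_apply, ih]
    simp only [smoothEig, shrinkFactor_succ, smul_eq_mul]
    ring

theorem waldStat_eq_sum (α : ℕ → ℝ) (y : Fin n → ℝ) (t : ℕ) :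
    waldStat H α x y t = (1 / (n : ℝ)) * ∑ i, smoothEig H x α t i ^ 2 *
      (empKernel_isHermitian H x).eigenvectorBasis.repr (WithLp.toLp 2 y) i ^ 2 := by
  rw [waldStat, ← sum_eigenvectorBasis_repr_sq (empKernel_isHermitian H x)]
  congr 1
  refine Finset.sum_congr rfl fun i _ => ?_
  rw [repr_gdIterate, mul_pow]

end Kernel

/-! ### From population eigenvalues to empirical eigenvalues -/

section Mercer

variable {𝒳 : Type*} {H : Type*} [NormedAddCommGroup H] [InnerProductSpace ℝ H]
  [CompleteSpace H] [RKHS ℝ H 𝒳 ℝ] [MeasurableSpace 𝒳] {PX : Measure 𝒳} {μ : ℕ → ℝ}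
  {φ : ℕ → 𝒳 → ℝ}

/-- Joint measurability comes from the expansion: the kernel is a pointwise limit of its measurable
partial sums. -/
theorem IsMercerSystem.measurable_kern (h : IsMercerSystem H PX μ φ) :
    Measurable fun p : 𝒳 × 𝒳 => kern H p.1 p.2 := by
  refine measurable_of_tendsto_metrizable
    (f := fun N p => ∑ i ∈ Finset.range N, μ i * φ i p.1 * φ i p.2) (fun N => ?_) ?_
  · refine Finset.measurable_sum _ fun i _ => ?_
    have := h.measurable i
    fun_prop
  · rw [tendsto_pi_nhds]
    exact fun p => (h.expansion p.1 p.2).tendsto_sum_nat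

theorem IsMercerSystem.measurable_gdIterate (h : IsMercerSystem H PX μ φ) {n : ℕ}
    {a : (Fin n → 𝒳) → ℕ → ℝ} (ha : ∀ τ, Measurable fun x => a x τ) (t : ℕ) (k : Fin n) :
    Measurable fun p : (Fin n → 𝒳) × (Fin n → ℝ) =>
      gdIterate H (a p.1) p.1 p.2 t (p.1 k) := by
  induction t generalizing k with
  | zero => simp [gdIterate]
  | succ t ih =>
    have e : (fun p : (Fin n → 𝒳) × (Fin n → ℝ) => gdIterate H (a p.1) p.1 p.2 (t + 1) (p.1 k)) =
        fun p => gdIterate H (a p.1) p.1 p.2 t (p.1 k) - a p.1 t * ((1 / (n : ℝ)) * ∑ i,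
          (gdIterate H (a p.1) p.1 p.2 t (p.1 i) - p.2 i) * kern H (p.1 k) (p.1 i)) :=
      funext fun p => gdIterate_succ_apply H p.1 (a p.1) p.2 t (p.1 k)
    rw [e]
    have hk (i : Fin n) : Measurable fun p : (Fin n → 𝒳) × (Fin n → ℝ) =>
        kern H (p.1 k) (p.1 i) := by
      have hp : Measurable fun p : (Fin n → 𝒳) × (Fin n → ℝ) => (p.1 k, p.1 i) := by fun_prop
      have := h.measurable_kern.comp hp
      exact this
    have hα : Measurable fun p : (Fin n → 𝒳) × (Fin n → ℝ) => a p.1 t :=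
      (ha t).comp measurable_fst
    have hy (i : Fin n) : Measurable fun p : (Fin n → 𝒳) × (Fin n → ℝ) => p.2 i := by fun_prop
    have hs := Finset.measurable_sum Finset.univ fun i _ => ((ih i).sub (hy i)).mul (hk i)
    exact (ih k).sub (hα.mul (hs.const_mul _))

theorem IsMercerSystem.measurable_waldStat (h : IsMercerSystem H PX μ φ) {n : ℕ}
    {a : (Fin n → 𝒳) → ℕ → ℝ} (ha : ∀ τ, Measurable fun x => a x τ) (t : ℕ) :
    Measurable fun p : (Fin n → 𝒳) × (Fin n → ℝ) => waldStat H (a p.1) p.1 p.2 t :=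
  measurable_const.mul (Finset.measurable_sum _ fun k _ =>
    (h.measurable_gdIterate ha t k).pow_const 2)

/-- Truncation of the Mercer expansion bounds the quadratic form of the kernel from below. -/
theorem IsMercerSystem.sum_le_dotProduct_empKernel (h : IsMercerSystem H PX μ φ) {n : ℕ}
    (x : Fin n → 𝒳) (w : Fin n → ℝ) (m : ℕ) :
    (1 / (n : ℝ)) * ∑ i ∈ Finset.range m, μ i * (∑ k, w k * φ i (x k)) ^ 2 ≤
      w ⬝ᵥ (empKernel H x).mulVec w := by
  rw [dotProduct_empKernel]
  refine mul_le_mul_of_nonneg_left ?_ (by positivity)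
  have hs : HasSum (fun i => ∑ k, ∑ l, w k * w l * (μ i * φ i (x k) * φ i (x l)))
      (∑ k, ∑ l, w k * w l * kern H (x k) (x l)) :=
    hasSum_sum fun k _ => hasSum_sum fun l _ => (h.expansion (x k) (x l)).mul_left _
  have e (i : ℕ) : ∑ k, ∑ l, w k * w l * (μ i * φ i (x k) * φ i (x l)) =
      μ i * (∑ k, w k * φ i (x k)) ^ 2 := by
    rw [sq, Finset.sum_mul_sum, Finset.mul_sum]
    refine Finset.sum_congr rfl fun k _ => ?_
    rw [Finset.mul_sum]
    exact Finset.sum_congr rfl fun l _ => by ring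
  simp_rw [e] at hs
  exact sum_le_hasSum _ (fun i _ => mul_nonneg (h.nonneg i) (sq_nonneg _)) hs

/-- The empirical Gram matrix of the first `m` eigenfunctions is close to the identity. -/
def GramClose (φ : ℕ → 𝒳 → ℝ) {n : ℕ} (x : Fin n → 𝒳) (m : ℕ) : Prop :=
  ∀ i j : Fin m, |(1 / (n : ℝ)) * ∑ k, φ i (x k) * φ j (x k) - if i = j then 1 else 0| ≤
    1 / (2 * m)

omit [MeasurableSpace 𝒳] in
-- Entrywise errors of `1/(2m)` change the quadratic form by at most `(∑ |u_i|)² / (2m)`, which is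
-- at most `½ ∑ u_i²` by Cauchy–Schwarz.
theorem GramClose.quadratic_ge {n m : ℕ} {x : Fin n → 𝒳} (hG : GramClose φ x m)
    (u : Fin m → ℝ) :
    (1 / 2) * ∑ i, u i ^ 2 ≤
      ∑ i, ∑ j, u i * u j * ((1 / (n : ℝ)) * ∑ k, φ i (x k) * φ j (x k)) := by
  rcases Nat.eq_zero_or_pos m with rfl | hm
  · simp
  have hm' : (0 : ℝ) < m := by exact_mod_cast hm
  have e : ∑ i, u i ^ 2 = ∑ i, ∑ j, u i * u j * (if i = j then 1 else 0) := by
    simp [sq]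
  have hcs : (∑ i, |u i|) ^ 2 ≤ m * ∑ i, u i ^ 2 := by
    have := sq_sum_le_card_mul_sum_sq (s := (Finset.univ : Finset (Fin m))) (f := fun i => |u i|)
    simpa using this
  have hb : ∑ i, ∑ j, u i * u j * (if i = j then 1 else 0) -
      ∑ i, ∑ j, u i * u j * ((1 / (n : ℝ)) * ∑ k, φ i (x k) * φ j (x k)) ≤
      1 / (2 * m) * (∑ i, |u i|) ^ 2 := by
    rw [← Finset.sum_sub_distrib, sq, Finset.sum_mul_sum, Finset.mul_sum]
    refine Finset.sum_le_sum fun i _ => ?_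
    rw [← Finset.sum_sub_distrib, Finset.mul_sum]
    refine Finset.sum_le_sum fun j _ => ?_
    rw [← mul_sub]
    refine (le_abs_self _).trans ?_
    rw [abs_mul, abs_mul, abs_sub_comm, mul_comm]
    exact mul_le_mul_of_nonneg_right (hG i j) (by positivity)
  have : 1 / (2 * m) * (∑ i, |u i|) ^ 2 ≤ (1 / 2) * ∑ i, u i ^ 2 := by
    calc 1 / (2 * m) * (∑ i, |u i|) ^ 2 ≤ 1 / (2 * m) * (m * ∑ i, u i ^ 2) :=
          mul_le_mul_of_nonneg_left hcs (by positivity)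
      _ = _ := by field_simp
  rw [← e] at hb
  linarith

/-- The map from coefficients to the values at the design points of the linear combinations of
the first `m` eigenfunctions. -/
def evalCombination (φ : ℕ → 𝒳 → ℝ) {n : ℕ} (x : Fin n → 𝒳) (m : ℕ) :
    (Fin m → ℝ) →ₗ[ℝ] (Fin n → ℝ) :=
  Matrix.mulVecLin (Matrix.of fun k i => φ (i : Fin m) (x k))

omit [MeasurableSpace 𝒳] in
theorem evalCombination_apply {n m : ℕ} (x : Fin n → 𝒳) (u : Fin m → ℝ) (k : Fin n) :
    evalCombination φ x m u k = ∑ i : Fin m, φ i (x k) * u i := rfl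

/-- Let `M` be the empirical Gram matrix, so that `G u = M u` and `‖L u‖² = n uᵀMu`. The truncated
Mercer form at `L u` is at least `r n |M u|²`, and `M ≥ ½` gives `|M u|² ≥ ½ uᵀMu`; hence the form
is at least `(r/2)‖L u‖²`. -/
theorem IsMercerSystem.card_eigenvalues_ge (h : IsMercerSystem H PX μ φ) {n m : ℕ} (hn : 1 ≤ n)
    {x : Fin n → 𝒳} (hG : GramClose φ x m) {r : ℝ} (hr : ∀ i : Fin m, r ≤ μ i) (hr0 : 0 ≤ r) :
    m ≤ (Finset.univ.filter fun i =>
      r / 2 ≤ (empKernel_isHermitian H x).eigenvalues i).card := by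
  have hn' : (0 : ℝ) < n := by exact_mod_cast hn
  set L := evalCombination φ x m with hL
  -- `G u i` is `⟨φ_i, L u⟩ₙ`
  let G (u : Fin m → ℝ) (i : Fin m) : ℝ := (1 / (n : ℝ)) * ∑ k, L u k * φ i (x k)
  have hGu (u) : ∑ i : Fin m, ∑ j : Fin m, u i * u j *
      ((1 / (n : ℝ)) * ∑ k, φ i (x k) * φ j (x k)) = ∑ i, u i * G u i := by
    refine Finset.sum_congr rfl fun i _ => ?_
    simp only [G, hL, evalCombination_apply, Finset.mul_sum, Finset.sum_mul]
    rw [Finset.sum_comm]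
    exact Finset.sum_congr rfl fun k _ => Finset.sum_congr rfl fun j _ => by ring
  have hLL (u) : L u ⬝ᵥ L u = n * ∑ i, u i * G u i := by
    have e : ∑ i, u i * ∑ k, L u k * φ i (x k) = L u ⬝ᵥ L u := by
      simp only [dotProduct, Finset.mul_sum]
      rw [Finset.sum_comm]
      refine Finset.sum_congr rfl fun k _ => ?_
      rw [show L u k * L u k = L u k * ∑ i : Fin m, φ i (x k) * u i from rfl, Finset.mul_sum]
      exact Finset.sum_congr rfl fun i _ => by ring
    rw [← e, Finset.mul_sum]
    refine Finset.sum_congr rfl fun i _ => ?_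
    simp only [G]; field_simp
  have hquad (u) : (1 / 2) * ∑ i, u i ^ 2 ≤ ∑ i, u i * G u i := hGu u ▸ hG.quadratic_ge u
  -- Cauchy–Schwarz gives `(uᵀMu)² ≤ |u|² |M u|²`, where `|u|² ≤ 2 uᵀMu`.
  have hGG (u) : (1 / 2) * ∑ i, u i * G u i ≤ ∑ i, G u i ^ 2 := by
    have hcs := Finset.sum_mul_sq_le_sq_mul_sq Finset.univ u (G u)
    have h0 : 0 ≤ ∑ i, u i ^ 2 := Finset.sum_nonneg fun i _ => sq_nonneg _
    have h1 := hquad u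
    have h2 : 0 ≤ ∑ i, G u i ^ 2 := Finset.sum_nonneg fun i _ => sq_nonneg _
    by_contra! hlt
    nlinarith
  refine EarlyStopping.card_eigenvalues_ge (empKernel_isHermitian H x) L (r / 2)
    (fun u hu => ?_) fun u => ?_
  · have h1 := hquad u
    have h2 := hLL u
    rw [hu] at h2
    have h3 : ∑ i, u i * G u i = 0 := by
      rw [zero_dotProduct] at h2
      rcases mul_eq_zero.1 h2.symm with h | h
      · exact absurd h hn'.ne'
      · exact h
    have h4 : ∑ i, u i ^ 2 = 0 :=
      le_antisymm (by linarith) (Finset.sum_nonneg fun i _ => sq_nonneg _)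
    funext i
    have := (Finset.sum_eq_zero_iff_of_nonneg (fun i _ => sq_nonneg (u i))).1 h4 i
      (Finset.mem_univ _)
    simpa using this
  · refine le_trans ?_ (h.sum_le_dotProduct_empKernel x (L u) m)
    have e : ∑ i ∈ Finset.range m, μ i * (∑ k, L u k * φ i (x k)) ^ 2 =
        ∑ i : Fin m, μ i * (n * G u i) ^ 2 := by
      rw [Finset.sum_range]
      refine Finset.sum_congr rfl fun i _ => ?_
      simp only [G]; field_simp
    have h1 : r * ∑ i, (n * G u i) ^ 2 ≤ ∑ i : Fin m, μ i * (n * G u i) ^ 2 := by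
      rw [Finset.mul_sum]
      exact Finset.sum_le_sum fun i _ => mul_le_mul_of_nonneg_right (hr i) (sq_nonneg _)
    rw [e, hLL]
    calc r / 2 * (n * ∑ i, u i * G u i) = r * n * ((1 / 2) * ∑ i, u i * G u i) := by ring
      _ ≤ r * n * ∑ i, G u i ^ 2 := mul_le_mul_of_nonneg_left (hGG u) (by positivity)
      _ = (1 / (n : ℝ)) * (r * ∑ i, (n * G u i) ^ 2) := by
          simp_rw [mul_pow]; rw [← Finset.mul_sum]; field_simp
      _ ≤ _ := mul_le_mul_of_nonneg_left h1 (by positivity)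

/-- At least `m` empirical eigenvalues satisfy `η λ ≥ 1/2`. Losing the factor `2` against the
population eigenvalues costs only a constant. -/
theorem IsMercerSystem.le_sum_smoothEig_pow_four (h : IsMercerSystem H PX μ φ) {n m : ℕ}
    (hn : 1 ≤ n) {x : Fin n → 𝒳} (hG : GramClose φ x m) {α : ℕ → ℝ} (h0 : ∀ τ, 0 ≤ α τ)
    (h1 : ∀ τ j, α τ * empEig H x j ≤ 1) {t : ℕ} (hκ : m ≤ kappa μ (totalStep α t)) :
    m * (1 - Real.exp (-(1 / 2))) ^ 4 ≤ ∑ i, smoothEig H x α t i ^ 4 := by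
  have hη : 0 ≤ totalStep α t := Finset.sum_nonneg fun τ _ => h0 τ
  have hμ : ∀ i : Fin m, 1 / totalStep α t ≤ μ i := fun i =>
    not_lt.1 (Nat.notMem_of_lt_sInf (lt_of_lt_of_le i.2 hκ))
  rcases Nat.eq_zero_or_pos m with rfl | hm
  · simpa using Finset.sum_nonneg fun i _ => (by positivity : 0 ≤ smoothEig H x α t i ^ 4)
  have hη0 : 0 < totalStep α t := by
    -- For `η = 0` the convention `1 / 0 = 0` empties the set defining `kappa`, and `sInf ∅ = 0`
    -- contradicts `0 < m`.
    refine lt_of_le_of_ne hη fun h' => ?_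
    have hk : kappa μ (totalStep α t) = 0 := by
      have : {j | μ j < 1 / totalStep α t} = ∅ := by
        ext j; simp [← h', h.nonneg j]
      rw [kappa, this, Nat.sInf_empty]
    omega
  have hcard := h.card_eigenvalues_ge hn hG hμ (by positivity)
  set s := Finset.univ.filter fun i =>
    1 / totalStep α t / 2 ≤ (empKernel_isHermitian H x).eigenvalues i
  have hc : 0 ≤ 1 - Real.exp (-(1 / 2)) := by
    rw [sub_nonneg, Real.exp_le_one_iff]; norm_num
  calc (m : ℝ) * (1 - Real.exp (-(1 / 2))) ^ 4
      ≤ s.card * (1 - Real.exp (-(1 / 2))) ^ 4 := by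
        gcongr
    _ = ∑ i ∈ s, (1 - Real.exp (-(1 / 2))) ^ 4 := by simp
    _ ≤ ∑ i ∈ s, smoothEig H x α t i ^ 4 := by
        refine Finset.sum_le_sum fun i hi => pow_le_pow_left₀ hc (le_trans ?_
          (smoothEig_ge H x h1 t i)) 4
        have hi' : 1 / totalStep α t / 2 ≤ (empKernel_isHermitian H x).eigenvalues i := by
          simpa [s] using hi
        have : 1 / 2 ≤ totalStep α t * (empKernel_isHermitian H x).eigenvalues i := by
          calc (1 : ℝ) / 2 = totalStep α t * (1 / totalStep α t / 2) := by field_simp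
            _ ≤ _ := mul_le_mul_of_nonneg_left hi' hη
        gcongr
    _ ≤ ∑ i, smoothEig H x α t i ^ 4 :=
        Finset.sum_le_sum_of_subset_of_nonneg (Finset.subset_univ _) fun i _ _ => by positivity

variable {Ω : Type*} [MeasurableSpace Ω] {P : Measure Ω}
  {X : ℕ → Ω → 𝒳}

/-- By the strong law of large numbers the empirical Gram matrix converges to the identity. -/
theorem IsMercerSystem.ae_eventually_gramClose (h : IsMercerSystem H PX μ φ)
    (hXm : ∀ i, Measurable (X i)) (hXlaw : ∀ i, P.map (X i) = PX) (hXind : iIndepFun X P)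
    (m : ℕ) : ∀ᵐ ω ∂P, ∀ᶠ n in atTop, GramClose φ (sample X n ω) m := by
  rcases Nat.eq_zero_or_pos m with rfl | hm
  · exact ae_of_all _ fun ω => Eventually.of_forall fun n i => i.elim0
  have hm' : (0 : ℝ) < m := by exact_mod_cast hm
  have key (i j : Fin m) : ∀ᵐ ω ∂P, Tendsto (fun n : ℕ =>
      (∑ k ∈ Finset.range n, φ i (X k ω) * φ j (X k ω)) / n) atTop
      (𝓝 (if i = j then 1 else 0)) := by
    have hφ : Measurable fun z => φ i z * φ j z := (h.measurable i).mul (h.measurable j)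
    have hident (k : ℕ) : IdentDistrib (fun ω => φ i (X k ω) * φ j (X k ω))
        (fun ω => φ i (X 0 ω) * φ j (X 0 ω)) P P := by
      have : IdentDistrib (X k) (X 0) P P :=
        ⟨(hXm k).aemeasurable, (hXm 0).aemeasurable, by rw [hXlaw, hXlaw]⟩
      exact this.comp hφ
    have hint0 : Integrable (fun z => φ i z * φ j z) (P.map (X 0)) := by
      rw [hXlaw]; exact (h.memLp i).integrable_mul (h.memLp j)
    have hint : Integrable (fun ω => φ i (X 0 ω) * φ j (X 0 ω)) P :=
      (integrable_map_measure hφ.aestronglyMeasurable (hXm 0).aemeasurable).1 hint0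
    have hslln := strong_law_ae_real (μ := P) (fun k ω => φ i (X k ω) * φ j (X k ω)) hint
      (fun k l hkl => (hXind.indepFun hkl).comp hφ hφ) hident
    have he : ∫ ω, φ i (X 0 ω) * φ j (X 0 ω) ∂P = if i = j then 1 else 0 := by
      rw [← integral_map (f := fun z => φ i z * φ j z) (hXm 0).aemeasurable
        hφ.aestronglyMeasurable, hXlaw, h.orthonormal]
      simp [Fin.ext_iff]
    rwa [he] at hslln
  have key' : ∀ᵐ ω ∂P, ∀ i j : Fin m, Tendsto (fun n : ℕ =>
      (∑ k ∈ Finset.range n, φ i (X k ω) * φ j (X k ω)) / n) atTop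
      (𝓝 (if i = j then 1 else 0)) :=
    ae_all_iff.2 fun i => ae_all_iff.2 fun j => key i j
  filter_upwards [key'] with ω hω
  simp only [GramClose, eventually_all]
  intro i j
  filter_upwards [Metric.tendsto_nhds.1 (hω i j) (1 / (2 * m)) (by positivity)] with n hn
  rw [Real.dist_eq, Finset.sum_range, div_eq_mul_inv, mul_comm, ← one_div] at hn
  exact hn.le

/-- Almost surely the indicators of the bad events are eventually zero, so their probabilities
vanish. -/
theorem IsMercerSystem.tendsto_measure_not_gramClose (h : IsMercerSystem H PX μ φ)
    [IsProbabilityMeasure P] (hXm : ∀ i, Measurable (X i)) (hXlaw : ∀ i, P.map (X i) = PX)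
    (hXind : iIndepFun X P) (m : ℕ) :
    Tendsto (fun n => P {ω | ¬ GramClose φ (sample X n ω) m}) atTop (𝓝 0) := by
  have hmeas (n : ℕ) : MeasurableSet {ω | ¬ GramClose φ (sample X n ω) m} := by
    have e : {ω | GramClose φ (sample X n ω) m} = ⋂ i : Fin m, ⋂ j : Fin m,
        {ω | |(1 / (n : ℝ)) * ∑ k, φ i (sample X n ω k) * φ j (sample X n ω k) -
          if i = j then 1 else 0| ≤ 1 / (2 * m)} := by
      ext ω; simp [GramClose]
    refine MeasurableSet.compl (s := {ω | GramClose φ (sample X n ω) m}) ?_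
    rw [e]
    refine MeasurableSet.iInter fun i => MeasurableSet.iInter fun j => ?_
    refine measurableSet_le ?_ measurable_const
    have hf (l : ℕ) (k : Fin n) : Measurable fun ω => φ l (sample X n ω k) :=
      (h.measurable l).comp (hXm k)
    have hs : Measurable fun ω => ∑ k, φ i (sample X n ω k) * φ j (sample X n ω k) :=
      Finset.measurable_sum _ fun k _ => (hf i k).mul (hf j k)
    exact (measurable_norm (α := ℝ)).comp ((hs.const_mul _).sub_const _)
  have := tendsto_measure_of_ae_tendsto_indicator (μ := P) (L := (atTop : Filter ℕ))
    (A := ∅) (As := fun n => {ω | ¬ GramClose φ (sample X n ω) m}) MeasurableSet.empty hmeas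
    (B := Set.univ) MeasurableSet.univ (by simp) (by simp) (by
      filter_upwards [h.ae_eventually_gramClose hXm hXlaw hXind m] with ω hω
      filter_upwards [hω] with n hn
      simp [hn])
  simpa using this

end Mercer

/-! ### The statistic for a fixed design -/

section FixedDesign

variable {𝒳 : Type*} (H : Type*) [NormedAddCommGroup H] [InnerProductSpace ℝ H]
  [CompleteSpace H] [RKHS ℝ H 𝒳 ℝ] {n : ℕ} (x : Fin n → 𝒳) (α : ℕ → ℝ) (t : ℕ) (v : NNReal)

theorem waldStat_eq_comp_repr :
    (fun e => waldStat H α x e t) =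
      (fun z : Fin n → ℝ => (1 / (n : ℝ)) * ∑ i, smoothEig H x α t i ^ 2 * z i ^ 2) ∘
        fun e => ((empKernel_isHermitian H x).eigenvectorBasis.repr (WithLp.toLp 2 e)).ofLp :=
  funext fun e => waldStat_eq_sum H x α e t

theorem nullMean_eq_sum :
    nullMean H v α x t = v / n * ∑ i, smoothEig H x α t i ^ 2 := by
  rw [nullMean, trace_one_sub_shrink_pow]

theorem nullVar_eq_sum :
    nullVar H v α x t = 2 * (v : ℝ) ^ 2 / (n : ℝ) ^ 2 * ∑ i, smoothEig H x α t i ^ 4 := by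
  rw [nullVar, trace_one_sub_shrink_pow]

theorem integral_comp_repr {F : (Fin n → ℝ) → ℝ} (hF : Measurable F) :
    ∫ e, F ((empKernel_isHermitian H x).eigenvectorBasis.repr (WithLp.toLp 2 e)).ofLp
        ∂(Measure.pi fun _ : Fin n => gaussianReal 0 v) =
      ∫ z, F z ∂(Measure.pi fun _ : Fin n => gaussianReal 0 v) := by
  have h := measurePreserving_repr_pi_gaussianReal v (empKernel_isHermitian H x).eigenvectorBasis
  conv_rhs => rw [← h.map_eq]
  exact (integral_map h.measurable.aemeasurable hF.aestronglyMeasurable).symm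

theorem memLp_waldStat :
    MemLp (fun e => waldStat H α x e t) 2 (Measure.pi fun _ : Fin n => gaussianReal 0 v) := by
  rw [waldStat_eq_comp_repr]
  exact ((memLp_weighted_sq_sum v _).const_mul _).comp_measurePreserving
    (measurePreserving_repr_pi_gaussianReal v _)

theorem integral_waldStat :
    ∫ e, waldStat H α x e t ∂(Measure.pi fun _ : Fin n => gaussianReal 0 v) =
      nullMean H v α x t := by
  simp_rw [waldStat_eq_sum]
  rw [integral_comp_repr H x v (F := fun z : Fin n → ℝ =>
    (1 / (n : ℝ)) * ∑ i, smoothEig H x α t i ^ 2 * z i ^ 2) (by fun_prop), integral_const_mul,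
    integral_weighted_sq_sum, nullMean_eq_sum]
  ring

theorem variance_waldStat :
    Var[fun e => waldStat H α x e t; Measure.pi fun _ : Fin n => gaussianReal 0 v] =
      nullVar H v α x t := by
  have h := measurePreserving_repr_pi_gaussianReal v (empKernel_isHermitian H x).eigenvectorBasis
  have hF : Measurable fun z : Fin n → ℝ =>
    (1 / (n : ℝ)) * ∑ i, smoothEig H x α t i ^ 2 * z i ^ 2 := by fun_prop
  rw [waldStat_eq_comp_repr, ← variance_map hF.aemeasurable h.measurable.aemeasurable, h.map_eq,
    variance_const_mul, variance_weighted_sq_sum, nullVar_eq_sum]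
  simp_rw [← pow_mul]
  ring

/-- This form of the variance serves twice: for the conditional variance, and for measurability of
`nullVar` in the design. -/
theorem integral_waldStat_sq :
    ∫ e, waldStat H α x e t ^ 2 ∂(Measure.pi fun _ : Fin n => gaussianReal 0 v) =
      nullVar H v α x t + nullMean H v α x t ^ 2 := by
  have h := variance_eq_sub (memLp_waldStat H x α t v)
  rw [variance_waldStat, integral_waldStat] at h
  have e : ∫ e, waldStat H α x e t ^ 2 ∂(Measure.pi fun _ : Fin n => gaussianReal 0 v) =
    ∫ e, ((fun e => waldStat H α x e t) ^ 2) e ∂(Measure.pi fun _ : Fin n => gaussianReal 0 v) :=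
    rfl
  rw [e]; linarith

/-- The bound does not involve the design or the step sizes, so the statistic is square integrable
under a random design as well. -/
theorem waldStat_le (hs : ∀ i, smoothEig H x α t i ∈ Set.Icc (0 : ℝ) 1) (e : Fin n → ℝ) :
    waldStat H α x e t ≤ (1 / (n : ℝ)) * ∑ i, e i ^ 2 := by
  rw [waldStat_eq_sum, ← sum_eigenvectorBasis_repr_sq (empKernel_isHermitian H x) e]
  refine mul_le_mul_of_nonneg_left (Finset.sum_le_sum fun i _ => ?_) (by positivity)
  exact mul_le_of_le_one_left (sq_nonneg _) (pow_le_one₀ (hs i).1 (hs i).2)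

theorem waldStat_nonneg (e : Fin n → ℝ) : 0 ≤ waldStat H α x e t :=
  mul_nonneg (by positivity) (Finset.sum_nonneg fun _ _ => sq_nonneg _)

end FixedDesign

/-- The law of `(z² / v - 1) / √2` for `z ∼ N(0, v)`. -/
def stdSqLaw (v : NNReal) : Measure ℝ :=
  (gaussianReal 0 v).map fun z => (z ^ 2 / v - 1) / √2

instance (v : NNReal) : IsProbabilityMeasure (stdSqLaw v) :=
  Measure.isProbabilityMeasure_map (by fun_prop)

theorem integral_stdSqLaw {v : NNReal} (hv : v ≠ 0) : ∫ w, w ∂(stdSqLaw v) = 0 := by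
  have hv' : (v : ℝ) ≠ 0 := by exact_mod_cast hv
  have hi : Integrable (fun z : ℝ => z ^ 2) (gaussianReal 0 v) :=
    (memLp_sq_gaussianReal v).integrable one_le_two
  rw [stdSqLaw, integral_map (by fun_prop) (by fun_prop), integral_div,
    integral_sub (hi.div_const _) (integrable_const _), integral_div, integral_pow_two_gaussianReal]
  simp [hv']

theorem integral_sq_stdSqLaw {v : NNReal} (hv : v ≠ 0) : ∫ w, w ^ 2 ∂(stdSqLaw v) = 1 := by
  have hv' : (v : ℝ) ≠ 0 := by exact_mod_cast hv
  have hvar := variance_sq_gaussianReal v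
  rw [variance_eq_integral (by fun_prop), integral_pow_two_gaussianReal] at hvar
  rw [stdSqLaw, integral_map (by fun_prop) (by fun_prop)]
  have e (z : ℝ) : ((z ^ 2 / v - 1) / √2) ^ 2 = (1 / (2 * (v : ℝ) ^ 2)) * (z ^ 2 - v) ^ 2 := by
    rw [div_pow, Real.sq_sqrt (by norm_num)]; field_simp
  simp_rw [e]
  rw [integral_const_mul, hvar]
  field_simp

/-- The central limit theorem for the statistic conditionally on the design, uniform in the
design and the step sizes. -/
theorem exists_waldStat_clt {v : NNReal} (hv : v ≠ 0) (g : BoundedContinuousFunction ℝ ℝ) {δ : ℝ}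
    (hδ : 0 < δ) : ∃ B : ℝ, ∀ {𝒳 : Type*} (H : Type*) [NormedAddCommGroup H]
      [InnerProductSpace ℝ H] [CompleteSpace H] [RKHS ℝ H 𝒳 ℝ] {n : ℕ} (_ : 1 ≤ n)
      (x : Fin n → 𝒳) (α : ℕ → ℝ) (t : ℕ), (∀ i, smoothEig H x α t i ∈ Set.Icc (0 : ℝ) 1) →
      B ≤ ∑ i, smoothEig H x α t i ^ 4 →
      |∫ e, g ((waldStat H α x e t - nullMean H v α x t) / √(nullVar H v α x t))
          ∂(Measure.pi fun _ : Fin n => gaussianReal 0 v) - ∫ z, g z ∂(gaussianReal 0 1)| ≤ δ := by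
  have hv' : (0 : ℝ) < v := by exact_mod_cast pos_iff_ne_zero.2 hv
  obtain ⟨B, hB0, hB⟩ := exists_weighted_clt (stdSqLaw v) (integral_stdSqLaw hv)
    (integral_sq_stdSqLaw hv) g hδ
  refine ⟨B, fun {𝒳} H _ _ _ _ n hn x α t hs hBs => ?_⟩
  have hn' : (0 : ℝ) < n := by exact_mod_cast hn
  set a : Fin n → ℝ := fun i => smoothEig H x α t i ^ 2 with ha
  have ha1 (i) : |a i| ≤ 1 := by
    rw [abs_of_nonneg (sq_nonneg _)]; exact pow_le_one₀ (hs i).1 (hs i).2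
  have ha4 : ∑ i, smoothEig H x α t i ^ 4 = ∑ i, a i ^ 2 :=
    Finset.sum_congr rfl fun i _ => by simp only [ha]; ring
  rw [ha4] at hBs
  have hq : 0 < √(∑ i, a i ^ 2) := Real.sqrt_pos.2 (hB0.trans_le hBs)
  have hsd : √(nullVar H v α x t) = v / n * √2 * √(∑ i, a i ^ 2) := by
    have : nullVar H v α x t = (v / n) ^ 2 * (2 * ∑ i, a i ^ 2) := by
      rw [nullVar_eq_sum, ha4]; ring
    rw [this, Real.sqrt_mul (sq_nonneg _), Real.sqrt_sq (by positivity),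
      Real.sqrt_mul (by norm_num)]
    ring
  have h2 : (0 : ℝ) < √2 := by positivity
  -- The scale `v / n` cancels: the standardized statistic is exactly a normalized weighted sum of
  -- independent variables with law `stdSqLaw v`.
  have hstd (z : Fin n → ℝ) :
      ((1 / (n : ℝ)) * ∑ i, a i * z i ^ 2 - nullMean H v α x t) / √(nullVar H v α x t) =
        (∑ i, a i * ((z i ^ 2 / v - 1) / √2)) / √(∑ i, a i ^ 2) := by
    have e : ∑ i, a i * ((z i ^ 2 / v - 1) / √2) =
        (1 / (v * √2)) * (∑ i, a i * z i ^ 2 - v * ∑ i, a i) := by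
      rw [Finset.mul_sum, ← Finset.sum_sub_distrib, Finset.mul_sum]
      refine Finset.sum_congr rfl fun i _ => ?_
      field_simp
    rw [e, hsd, nullMean_eq_sum]
    change ((1 / (n : ℝ)) * ∑ i, a i * z i ^ 2 - v / n * ∑ i, a i) / _ = _
    field_simp
  have hmap : (Measure.pi fun _ : Fin n => gaussianReal 0 v).map
      (fun z i => (z i ^ 2 / v - 1) / √2) = Measure.pi fun _ : Fin n => stdSqLaw v :=
    Measure.pi_map_pi (f := fun (_ : Fin n) (z : ℝ) => (z ^ 2 / v - 1) / √2)
      (fun i => by fun_prop)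
  have key := hB n a ha1 hBs
  have hg : Measurable fun w : Fin n → ℝ => g ((∑ j, a j * w j) / √(∑ j, a j ^ 2)) :=
    g.continuous.measurable.comp (by fun_prop)
  have hf : Measurable fun (z : Fin n → ℝ) i => (z i ^ 2 / v - 1) / √2 := by fun_prop
  rw [← hmap, integral_map hf.aemeasurable hg.aestronglyMeasurable] at key
  simp_rw [waldStat_eq_sum]
  have hF : Measurable fun z : Fin n → ℝ =>
      g (((1 / (n : ℝ)) * ∑ i, a i * z i ^ 2 - nullMean H v α x t) / √(nullVar H v α x t)) :=
    g.continuous.measurable.comp (by fun_prop)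
  rw [integral_comp_repr H x v hF]
  simp_rw [hstd]
  exact key

/-! ### Measurability, bounded convergence and the law of the noise -/

theorem measurableSet_le_kappa (μ : ℕ → ℝ) (m : ℕ) : MeasurableSet {η | m ≤ kappa μ η} := by
  have hj (j : ℕ) : MeasurableSet {η : ℝ | μ j < 1 / η} :=
    measurableSet_lt measurable_const (by fun_prop)
  rcases Nat.eq_zero_or_pos m with rfl | hm
  · simp
  -- The union excludes the case where no index qualifies, in which `sInf ∅ = 0 < m`.
  have e : {η | m ≤ kappa μ η} =
      (⋃ j, {η : ℝ | μ j < 1 / η}) ∩ ⋂ j : Fin m, {η : ℝ | μ j < 1 / η}ᶜ := by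
    ext η
    simp only [Set.mem_ofPred_eq, Set.mem_inter_iff, Set.mem_iUnion, Set.mem_iInter,
      Set.mem_compl_iff]
    constructor
    · intro h
      refine ⟨?_, fun j => Nat.notMem_of_lt_sInf (lt_of_lt_of_le j.2 h)⟩
      by_contra! hc
      have : {j | μ j < 1 / η} = ∅ := by ext j; simpa using hc j
      rw [kappa, this, Nat.sInf_empty] at h
      omega
    · rintro ⟨⟨j, hj'⟩, h⟩
      by_contra! hc
      exact h ⟨kappa μ η, hc⟩ (Nat.sInf_mem (s := {j | μ j < 1 / η}) ⟨j, hj'⟩)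
  rw [e]
  exact (MeasurableSet.iUnion hj).inter (MeasurableSet.iInter fun j => (hj j).compl)

/-- Bounded convergence for a family that converges in measure to a constant. -/
theorem tendsto_integral_of_tendstoInMeasure_const {Ω ι : Type*} [MeasurableSpace Ω]
    {P : Measure Ω} [IsProbabilityMeasure P] {l : Filter ι} {F : ι → Ω → ℝ} {c C : ℝ}
    (hm : ∀ i, AEStronglyMeasurable (F i) P) (hC : ∀ i, ∀ᵐ ω ∂P, |F i ω| ≤ C)
    (h : TendstoInMeasure P F l fun _ => c) : Tendsto (fun i => ∫ ω, F i ω ∂P) l (𝓝 c) := by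
  rw [tendstoInMeasure_iff_dist] at h
  rw [Metric.tendsto_nhds]
  intro ε hε
  set A : ι → Set Ω := fun i => toMeasurable P {ω | ε / 2 ≤ dist (F i ω) c}
  have hA := h (ε / 2) (half_pos hε)
  have hA' : Tendsto (fun i => ε / 2 + (|C| + |c|) * P.real (A i)) l
      (𝓝 (ε / 2 + (|C| + |c|) * 0)) := by
    refine tendsto_const_nhds.add (tendsto_const_nhds.mul ?_)
    have := (ENNReal.tendsto_toReal ENNReal.zero_ne_top).comp hA
    simpa [A, Measure.real, measure_toMeasurable, Function.comp_def] using this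
  filter_upwards [hA'.eventually (gt_mem_nhds (show _ < ε by linarith))] with i hi
  have hint : Integrable (F i) P := Integrable.of_bound (hm i) C (hC i)
  have hAm : MeasurableSet (A i) := measurableSet_toMeasurable _ _
  have e : ∫ ω, F i ω ∂P - c = ∫ ω, (F i ω - c) ∂P := by
    rw [integral_sub hint (integrable_const _)]; simp
  rw [Real.dist_eq, e]
  refine lt_of_le_of_lt ?_ hi
  calc |∫ ω, (F i ω - c) ∂P| ≤ ∫ ω, |F i ω - c| ∂P := abs_integral_le_integral_abs
    _ ≤ ∫ ω, (ε / 2 + (A i).indicator (fun _ => |C| + |c|) ω) ∂P := by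
        refine integral_mono_ae (hint.sub (integrable_const _)).abs
          ((integrable_const _).add ((integrable_const _).indicator hAm)) ?_
        filter_upwards [hC i] with ω hω
        by_cases hmem : ω ∈ A i
        · rw [Set.indicator_of_mem hmem]
          have h1 := abs_sub (F i ω) c
          have h2 := le_abs_self C
          linarith
        · rw [Set.indicator_of_notMem hmem, add_zero]
          have : ω ∉ {ω | ε / 2 ≤ dist (F i ω) c} := fun h' =>
            hmem (subset_toMeasurable _ _ h')
          simp only [Set.mem_ofPred_eq, not_le, Real.dist_eq] at this
          exact this.le
    _ = ε / 2 + (|C| + |c|) * P.real (A i) := by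
        rw [integral_add (integrable_const _) ((integrable_const _).indicator hAm),
          integral_indicator_const _ hAm]
        simp [mul_comm]

theorem map_sample_gaussian {Ω : Type*} [MeasurableSpace Ω] {P : Measure Ω}
    [IsProbabilityMeasure P] {v : NNReal} {ε : ℕ → Ω → ℝ} (hεm : ∀ i, Measurable (ε i))
    (hεlaw : ∀ i, P.map (ε i) = gaussianReal 0 v) (hεind : iIndepFun ε P) (n : ℕ) :
    P.map (sample ε n) = Measure.pi fun _ : Fin n => gaussianReal 0 v := by
  have h := hεind.precomp (Fin.val_injective (n := n))
  have := (iIndepFun_iff_map_fun_eq_pi_map (fun i => (hεm _).aemeasurable)).1 h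
  have e : P.map (fun ω (i : Fin n) => ε i ω) = Measure.pi fun _ : Fin n => gaussianReal 0 v := by
    simpa [hεlaw] using this
  exact e

/-! ### The random design -/

section Model

variable {Ω 𝒳 : Type*} [MeasurableSpace Ω] [MeasurableSpace 𝒳]
  {H : Type*} [NormedAddCommGroup H] [InnerProductSpace ℝ H] [CompleteSpace H] [RKHS ℝ H 𝒳 ℝ]
  {P : Measure Ω} {PX : Measure 𝒳} {X : ℕ → Ω → 𝒳} {v : NNReal} {ε : ℕ → Ω → ℝ}
  {μ : ℕ → ℝ} {φ : ℕ → 𝒳 → ℝ} {α : StepRule 𝒳}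

omit [MeasurableSpace Ω] [MeasurableSpace 𝒳] in
variable (H) in
theorem nullStat_eq_waldStat (X : ℕ → Ω → 𝒳) (ε : ℕ → Ω → ℝ) (α : StepRule 𝒳) (n t : ℕ) (ω : Ω) :
    nullStat H X ε α n t ω =
      waldStat H (α n (sample X n ω)) (sample X n ω) (sample ε n ω) t := by
  have : response (0 : H) (sample X n ω) (sample ε n ω) = sample ε n ω := by
    funext i; simp [response]
  rw [nullStat, this]

theorem measurable_sample {E : Type*} [MeasurableSpace E] {Z : ℕ → Ω → E}
    (hZ : ∀ i, Measurable (Z i)) (n : ℕ) : Measurable (sample Z n) :=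
  measurable_pi_iff.2 fun i => hZ i

theorem indepFun_sample (hXε : IndepFun (fun ω i => X i ω) (fun ω i => ε i ω) P) (n : ℕ) :
    IndepFun (sample X n) (sample ε n) P := by
  have h1 : Measurable fun (z : ℕ → 𝒳) (i : Fin n) => z i := by fun_prop
  have h2 : Measurable fun (z : ℕ → ℝ) (i : Fin n) => z i := by fun_prop
  exact hXε.comp h1 h2

theorem StepSizeConditions.ae_smoothEig_mem_Icc (hα : StepSizeConditions H P X α) {n : ℕ}
    (hn : 1 ≤ n) : ∀ᵐ ω ∂P, ∀ t i,
      smoothEig H (sample X n ω) (α n (sample X n ω)) t i ∈ Set.Icc (0 : ℝ) 1 := by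
  filter_upwards [hα.nonneg n hn, hα.mul_eig_le_one n hn] with ω h0 h1 t i
  exact smoothEig_mem_Icc H _ h0 h1 t i

/-- The null mean and variance are integrals over the noise of jointly measurable functions.
Measurability of the empirical eigenvalues in the design is thereby bypassed. -/
theorem measurable_stdStat_prod (h : IsMercerSystem H PX μ φ)
    (hα : ∀ n τ, Measurable fun x => α n x τ) (v : NNReal) (n t : ℕ) :
    Measurable fun p : (Fin n → 𝒳) × (Fin n → ℝ) =>
      (waldStat H (α n p.1) p.1 p.2 t - nullMean H v (α n p.1) p.1 t) /
        √(nullVar H v (α n p.1) p.1 t) := by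
  have hW := h.measurable_waldStat (hα n) t
  have hmean : Measurable fun x : Fin n → 𝒳 => nullMean H v (α n x) x t := by
    simp_rw [← integral_waldStat]
    exact (hW.stronglyMeasurable.integral_prod_right'
      (ν := Measure.pi fun _ : Fin n => gaussianReal 0 v)).measurable
  have hvar : Measurable fun x : Fin n → 𝒳 => nullVar H v (α n x) x t := by
    have e : (fun x : Fin n → 𝒳 => nullVar H v (α n x) x t) = fun x =>
        ∫ e, waldStat H (α n x) x e t ^ 2 ∂(Measure.pi fun _ : Fin n => gaussianReal 0 v) -
          nullMean H v (α n x) x t ^ 2 := by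
      funext x; rw [integral_waldStat_sq]; ring
    rw [e]
    exact ((hW.pow_const 2).stronglyMeasurable.integral_prod_right'
      (ν := Measure.pi fun _ : Fin n => gaussianReal 0 v)).measurable.sub (hmean.pow_const 2)
  exact (hW.sub (hmean.comp measurable_fst)).div (hvar.comp measurable_fst).sqrt

omit [MeasurableSpace Ω] [MeasurableSpace 𝒳] in
theorem stdStat_eq (v : NNReal) (X : ℕ → Ω → 𝒳) (ε : ℕ → Ω → ℝ) (α : StepRule 𝒳) (n t : ℕ) :
    stdStat H v X ε α n t = (fun p : (Fin n → 𝒳) × (Fin n → ℝ) =>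
      (waldStat H (α n p.1) p.1 p.2 t - nullMean H v (α n p.1) p.1 t) /
        √(nullVar H v (α n p.1) p.1 t)) ∘ fun ω => (sample X n ω, sample ε n ω) := by
  funext ω
  simp only [stdStat, nullStat_eq_waldStat, Function.comp_apply]

theorem measurable_stdStat (h : IsMercerSystem H PX μ φ) (hXm : ∀ i, Measurable (X i))
    (hεm : ∀ i, Measurable (ε i)) (hα : ∀ n τ, Measurable fun x => α n x τ) (v : NNReal)
    (n t : ℕ) : Measurable (stdStat H v X ε α n t) := by
  rw [stdStat_eq]
  exact (measurable_stdStat_prod h hα v n t).comp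
    ((measurable_sample hXm n).prodMk (measurable_sample hεm n))

variable [IsProbabilityMeasure P]

omit [IsProbabilityMeasure P] in
theorem memLp_nullStat (h : IsMercerSystem H PX μ φ) (hXm : ∀ i, Measurable (X i))
    (hεm : ∀ i, Measurable (ε i)) (hεlaw : ∀ i, P.map (ε i) = gaussianReal 0 v)
    (hα : StepSizeConditions H P X α) {n : ℕ} (hn : 1 ≤ n) (t : ℕ) :
    MemLp (nullStat H X ε α n t) 2 P := by
  have hb : MemLp (fun ω => (1 / (n : ℝ)) * ∑ i : Fin n, ε i ω ^ 2) 2 P := by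
    have hi (i : ℕ) : MemLp (fun ω => ε i ω ^ 2) 2 P := by
      have := memLp_sq_gaussianReal v
      rw [← hεlaw i] at this
      exact (memLp_map_measure_iff (by fun_prop) (hεm i).aemeasurable).1 this
    exact (memLp_finsetSum Finset.univ fun (i : Fin n) _ => hi i).const_mul (1 / (n : ℝ))
  refine hb.of_le ?_ ?_
  · have e : nullStat H X ε α n t = (fun p : (Fin n → 𝒳) × (Fin n → ℝ) =>
        waldStat H (α n p.1) p.1 p.2 t) ∘ fun ω => (sample X n ω, sample ε n ω) :=
      funext fun ω => nullStat_eq_waldStat H X ε α n t ω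
    rw [e]
    exact ((h.measurable_waldStat (hα.measurable n) t).comp
      ((measurable_sample hXm n).prodMk (measurable_sample hεm n))).aestronglyMeasurable
  · filter_upwards [hα.ae_smoothEig_mem_Icc hn] with ω hω
    rw [nullStat_eq_waldStat, Real.norm_of_nonneg (waldStat_nonneg _ _ _ _ _)]
    exact (waldStat_le H _ _ t (hω t) _).trans (le_abs_self _)

/-- Conditional expectations given the design are integrals over the noise. -/
theorem condExp_design (hXm : ∀ i, Measurable (X i)) (hεm : ∀ i, Measurable (ε i))
    (hεlaw : ∀ i, P.map (ε i) = gaussianReal 0 v) (hεind : iIndepFun ε P)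
    (hXε : IndepFun (fun ω i => X i ω) (fun ω i => ε i ω) P) {n : ℕ}
    {G : (Fin n → 𝒳) × (Fin n → ℝ) → ℝ} (hG : Measurable G)
    (hint : Integrable (fun ω => G (sample X n ω, sample ε n ω)) P) :
    P[fun ω => G (sample X n ω, sample ε n ω) | designSigma X n] =ᵐ[P] fun ω =>
      ∫ e, G (sample X n ω, e) ∂(Measure.pi fun _ : Fin n => gaussianReal 0 v) := by
  have := condExp_prod_of_indepFun (measurable_sample hXm n) (measurable_sample hεm n)
    (indepFun_sample hXε n) hG hint
  rwa [map_sample_gaussian hεm hεlaw hεind n] at this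

theorem condExp_nullStat (h : IsMercerSystem H PX μ φ) (hXm : ∀ i, Measurable (X i))
    (hεm : ∀ i, Measurable (ε i)) (hεlaw : ∀ i, P.map (ε i) = gaussianReal 0 v)
    (hεind : iIndepFun ε P) (hXε : IndepFun (fun ω i => X i ω) (fun ω i => ε i ω) P)
    (hα : StepSizeConditions H P X α) {n : ℕ} (hn : 1 ≤ n) (t : ℕ) :
    P[nullStat H X ε α n t | designSigma X n] =ᵐ[P]
      fun ω => nullMean H v (α n (sample X n ω)) (sample X n ω) t := by
  have hL := memLp_nullStat h hXm hεm hεlaw hα hn t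
  have e : nullStat H X ε α n t = fun ω => (fun p : (Fin n → 𝒳) × (Fin n → ℝ) =>
      waldStat H (α n p.1) p.1 p.2 t) (sample X n ω, sample ε n ω) :=
    funext fun ω => nullStat_eq_waldStat H X ε α n t ω
  have hi := hL.integrable one_le_two
  rw [e] at hi ⊢
  refine (condExp_design hXm hεm hεlaw hεind hXε
    (h.measurable_waldStat (hα.measurable n) t) hi).trans (ae_of_all _ fun ω => ?_)
  exact integral_waldStat H (sample X n ω) (α n (sample X n ω)) t v

theorem condVar_nullStat (h : IsMercerSystem H PX μ φ) (hXm : ∀ i, Measurable (X i))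
    (hεm : ∀ i, Measurable (ε i)) (hεlaw : ∀ i, P.map (ε i) = gaussianReal 0 v)
    (hεind : iIndepFun ε P) (hXε : IndepFun (fun ω i => X i ω) (fun ω i => ε i ω) P)
    (hα : StepSizeConditions H P X α) {n : ℕ} (hn : 1 ≤ n) (t : ℕ) :
    condVar (designSigma X n) (nullStat H X ε α n t) P =ᵐ[P]
      fun ω => nullVar H v (α n (sample X n ω)) (sample X n ω) t := by
  have hL := memLp_nullStat h hXm hεm hεlaw hα hn t
  have e : nullStat H X ε α n t ^ 2 = fun ω => (fun p : (Fin n → 𝒳) × (Fin n → ℝ) =>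
      waldStat H (α n p.1) p.1 p.2 t ^ 2) (sample X n ω, sample ε n ω) :=
    funext fun ω => by rw [Pi.pow_apply, nullStat_eq_waldStat]
  have hi : Integrable (nullStat H X ε α n t ^ 2) P := hL.integrable_sq
  rw [e] at hi
  have h2 := condExp_design hXm hεm hεlaw hεind hXε
    ((h.measurable_waldStat (hα.measurable n) t).pow_const 2) hi
  rw [← e] at h2
  filter_upwards [condVar_ae_eq_condExp_sq_sub_sq_condExp (measurable_sample hXm n).comap_le hL,
    h2, condExp_nullStat h hXm hεm hεlaw hεind hXε hα hn t] with ω a1 a2 a3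
  rw [a1, Pi.sub_apply, Pi.pow_apply, a3, a2]
  have := integral_waldStat_sq H (sample X n ω) (α n (sample X n ω)) t v
  simp only [this]
  ring

/-- The trace of `(I - Sᵗ)⁴` diverges in probability. -/
theorem tendsto_measure_sum_smoothEig_lt (h : IsMercerSystem H PX μ φ)
    (hXm : ∀ i, Measurable (X i)) (hXlaw : ∀ i, P.map (X i) = PX) (hXind : iIndepFun X P)
    (hα : StepSizeConditions H P X α) (hκ : KappaDiverges P X α μ) (B : ℝ) :
    Tendsto (fun p : ℕ × ℕ => P {ω | ∑ i, smoothEig H (sample X p.1 ω)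
      (α p.1 (sample X p.1 ω)) p.2 i ^ 4 < B}) (atTop ×ˢ atTop) (𝓝 0) := by
  have hc : 0 < (1 - Real.exp (-(1 / 2))) ^ 4 := by
    have : Real.exp (-(1 / 2)) < 1 := 
      (Real.exp_lt_exp.2 (by norm_num : (-(1 / 2) : ℝ) < 0)).trans_eq Real.exp_zero
    exact pow_pos (by linarith) 4
  -- This `m` depends on `B` only, so the law of large numbers applies to a Gram matrix of fixed
  -- size.
  obtain ⟨m, hm⟩ := exists_nat_ge (B / (1 - Real.exp (-(1 / 2))) ^ 4)
  rw [div_le_iff₀ hc] at hm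
  have hη (n t : ℕ) : Measurable (etaR X α n t) := by
    have : Measurable fun x : Fin n → 𝒳 => totalStep (α n x) t :=
      Finset.measurable_sum _ fun τ _ => hα.measurable n τ
    exact this.comp (measurable_sample hXm n)
  have h1 := (h.tendsto_measure_not_gramClose hXm hXlaw hXind m).comp
    (tendsto_fst (f := (atTop : Filter ℕ)) (g := (atTop : Filter ℕ)))
  have h2 : Tendsto (fun p : ℕ × ℕ => P {ω | m ≤ kappa μ (etaR X α p.1 p.2 ω)}ᶜ)
      (atTop ×ˢ atTop) (𝓝 0) := by
    have := ENNReal.Tendsto.sub (tendsto_const_nhds (x := (1 : ENNReal))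
      (f := (atTop ×ˢ atTop : Filter (ℕ × ℕ)))) (hκ m) (Or.inl ENNReal.one_ne_top)
    rw [tsub_self] at this
    refine this.congr fun p => ?_
    exact (prob_compl_eq_one_sub ((hη p.1 p.2) (measurableSet_le_kappa μ m))).symm
  have h3 := h1.add h2
  rw [add_zero] at h3
  refine tendsto_of_tendsto_of_tendsto_of_le_of_le' tendsto_const_nhds h3
    (Eventually.of_forall fun _ => zero_le) ?_
  have hn1 : ∀ᶠ p : ℕ × ℕ in atTop ×ˢ atTop, 1 ≤ p.1 :=
    tendsto_fst.eventually (eventually_ge_atTop 1)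
  filter_upwards [hn1] with p hp
  -- Up to a null set, a sum below `B` requires a bad Gram matrix or `kappa < m`.
  refine le_trans (measure_mono_ae ?_) (measure_union_le _ _)
  filter_upwards [hα.nonneg p.1 hp, hα.mul_eig_le_one p.1 hp] with ω a0 a1 hω
  by_contra hcon
  have hcon' := not_or.1 hcon
  have hG : GramClose φ (sample X p.1 ω) m := not_not.1 hcon'.1
  have hk : m ≤ kappa μ (etaR X α p.1 p.2 ω) := not_not.1 hcon'.2
  have := h.le_sum_smoothEig_pow_four hp hG a0 a1 hk
  exact absurd (hm.trans this) (not_le.2 hω)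

/-- For almost every design the conditional expectation is an integral over the noise alone. The
uniform central limit theorem controls it whenever `∑ s_i⁴ ≥ B`, and the exceptional event has
vanishing probability. -/
theorem tendstoInMeasure_condExp_stdStat (h : IsMercerSystem H PX μ φ)
    (hXm : ∀ i, Measurable (X i)) (hXlaw : ∀ i, P.map (X i) = PX) (hXind : iIndepFun X P)
    (hv : v ≠ 0) (hεm : ∀ i, Measurable (ε i)) (hεlaw : ∀ i, P.map (ε i) = gaussianReal 0 v)
    (hεind : iIndepFun ε P) (hXε : IndepFun (fun ω i => X i ω) (fun ω i => ε i ω) P)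
    (hα : StepSizeConditions H P X α) (hκ : KappaDiverges P X α μ)
    (g : BoundedContinuousFunction ℝ ℝ) :
    TendstoInMeasure P (fun p : ℕ × ℕ => P[fun ω => g (stdStat H v X ε α p.1 p.2 ω) |
      designSigma X p.1]) (atTop ×ˢ atTop) (fun _ => ∫ z, g z ∂(gaussianReal 0 1)) := by
  rw [tendstoInMeasure_iff_dist]
  intro δ hδ
  -- Half of `δ`, since the bad event is `δ ≤ dist` and the bound obtained is not strict.
  obtain ⟨B, hB⟩ := exists_waldStat_clt hv g (half_pos hδ)
  refine tendsto_of_tendsto_of_tendsto_of_le_of_le' tendsto_const_nhds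
    (tendsto_measure_sum_smoothEig_lt h hXm hXlaw hXind hα hκ B)
    (Eventually.of_forall fun _ => zero_le) ?_
  have hn1 : ∀ᶠ p : ℕ × ℕ in atTop ×ˢ atTop, 1 ≤ p.1 :=
    tendsto_fst.eventually (eventually_ge_atTop 1)
  filter_upwards [hn1] with p hp
  refine measure_mono_ae ?_
  have hF := g.continuous.measurable.comp (measurable_stdStat_prod h hα.measurable v p.1 p.2)
  have hmeas := g.continuous.measurable.comp
    (measurable_stdStat h hXm hεm hα.measurable v p.1 p.2)
  have hint : Integrable (fun ω => g (stdStat H v X ε α p.1 p.2 ω)) P :=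
    Integrable.of_bound hmeas.aestronglyMeasurable ‖g‖ (ae_of_all _ fun ω => g.norm_coe_le_norm _)
  have e := stdStat_eq (H := H) v X ε α p.1 p.2
  rw [e] at hint ⊢
  filter_upwards [condExp_design hXm hεm hεlaw hεind hXε hF hint,
    hα.ae_smoothEig_mem_Icc hp] with ω a1 a2 hω
  by_contra hcon
  have hBs : B ≤ ∑ i, smoothEig H (sample X p.1 ω) (α p.1 (sample X p.1 ω)) p.2 i ^ 4 :=
    not_lt.1 hcon
  have hle := hB H hp (sample X p.1 ω) (α p.1 (sample X p.1 ω)) p.2 (a2 p.2) hBs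
  have hω' : δ ≤ dist _ _ := hω
  rw [Real.dist_eq] at hω'
  have a1' := a1
  simp only [Function.comp_apply] at a1' hω'
  rw [a1'] at hω'
  linarith

theorem tendstoInDistribution_stdStat (h : IsMercerSystem H PX μ φ)
    (hXm : ∀ i, Measurable (X i)) (hXlaw : ∀ i, P.map (X i) = PX) (hXind : iIndepFun X P)
    (hv : v ≠ 0) (hεm : ∀ i, Measurable (ε i)) (hεlaw : ∀ i, P.map (ε i) = gaussianReal 0 v)
    (hεind : iIndepFun ε P) (hXε : IndepFun (fun ω i => X i ω) (fun ω i => ε i ω) P)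
    (hα : StepSizeConditions H P X α) (hκ : KappaDiverges P X α μ) :
    TendstoInDistribution (fun p : ℕ × ℕ => stdStat H v X ε α p.1 p.2)
      (atTop ×ˢ atTop) (id : ℝ → ℝ) (fun _ => P) (gaussianReal 0 1) := by
  have hS (p : ℕ × ℕ) := measurable_stdStat h hXm hεm hα.measurable v p.1 p.2
  refine ⟨fun p => (hS p).aemeasurable, aemeasurable_id, ?_⟩
  refine ProbabilityMeasure.tendsto_iff_forall_integral_tendsto.2 fun g => ?_
  have hbdd (p : ℕ × ℕ) : ∀ᵐ ω ∂P,
      |(P[fun ω => g (stdStat H v X ε α p.1 p.2 ω) | designSigma X p.1]) ω| ≤ ‖g‖ :=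
    ae_bdd_abs_condExp_of_ae_bdd_abs
      (ae_of_all _ fun ω => g.norm_coe_le_norm (stdStat H v X ε α p.1 p.2 ω))
  have hsm (p : ℕ × ℕ) : AEStronglyMeasurable
      (P[fun ω => g (stdStat H v X ε α p.1 p.2 ω) | designSigma X p.1]) P :=
    integrable_condExp.aestronglyMeasurable
  have hlim := tendstoInMeasure_condExp_stdStat h hXm hXlaw hXind hv hεm hεlaw hεind hXε hα hκ g
  have hint : Tendsto (fun p : ℕ × ℕ => ∫ ω, (P[fun ω => g (stdStat H v X ε α p.1 p.2 ω) |
      designSigma X p.1]) ω ∂P) (atTop ×ˢ atTop) (𝓝 (∫ z, g z ∂(gaussianReal 0 1))) :=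
    tendsto_integral_of_tendstoInMeasure_const hsm hbdd hlim
  have e0 : ∫ z, g z ∂((gaussianReal 0 1).map id) = ∫ z, g z ∂(gaussianReal 0 1) := by
    rw [Measure.map_id]
  have e1 (p : ℕ × ℕ) : ∫ ω, (P[fun ω => g (stdStat H v X ε α p.1 p.2 ω) |
      designSigma X p.1]) ω ∂P = ∫ z, g z ∂(P.map (stdStat H v X ε α p.1 p.2)) := by
    rw [integral_condExp (measurable_sample hXm p.1).comap_le,
      integral_map (hS p).aemeasurable g.continuous.aestronglyMeasurable]
  rw [← e0] at hint
  exact hint.congr e1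

end Model

end EarlyStopping

end

theorem theorem1 {Ω 𝒳 : Type*} [MeasurableSpace Ω] [MeasurableSpace 𝒳]
    (H : Type*) [NormedAddCommGroup H] [InnerProductSpace ℝ H] [CompleteSpace H] [RKHS ℝ H 𝒳 ℝ]
    -- the model: design points i.i.d. with law `PX`, independent i.i.d. `N(0, v)` noise
    (P : Measure Ω) [IsProbabilityMeasure P] (PX : Measure 𝒳) [IsProbabilityMeasure PX]
    (X : ℕ → Ω → 𝒳) (hXm : ∀ i, Measurable (X i)) (hXlaw : ∀ i, P.map (X i) = PX)
    (hXind : iIndepFun X P)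
    (v : NNReal) (hv : v ≠ 0)
    (ε : ℕ → Ω → ℝ) (hεm : ∀ i, Measurable (ε i)) (hεlaw : ∀ i, P.map (ε i) = gaussianReal 0 v)
    (hεind : iIndepFun ε P)
    (hXε : IndepFun (fun ω i => X i ω) (fun ω i => ε i ω) P)
    -- Mercer expansion with uniformly bounded eigenfunctions
    (μ : ℕ → ℝ) (φ : ℕ → 𝒳 → ℝ) (hMercer : EarlyStopping.IsMercerSystem H PX μ φ)
    (hbdd : ∃ c : ℝ, ∀ i z, |φ i z| ≤ c)
    -- step sizes
    (α : EarlyStopping.StepRule 𝒳) (hα : EarlyStopping.StepSizeConditions H P X α)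
    (hκ : EarlyStopping.KappaDiverges P X α μ) :
    -- conditional mean and variance of the statistic given the design
    (∀ n t : ℕ, 1 ≤ n →
      MemLp (EarlyStopping.nullStat H X ε α n t) 2 P ∧
      P[EarlyStopping.nullStat H X ε α n t | EarlyStopping.designSigma X n] =ᵐ[P]
        (fun ω => EarlyStopping.nullMean H v (α n (EarlyStopping.sample X n ω))
          (EarlyStopping.sample X n ω) t) ∧
      condVar (EarlyStopping.designSigma X n) (EarlyStopping.nullStat H X ε α n t) P =ᵐ[P]
        (fun ω => EarlyStopping.nullVar H v (α n (EarlyStopping.sample X n ω))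
          (EarlyStopping.sample X n ω) t)) ∧
    -- the conditional law given the design tends weakly to `N(0, 1)`, in probability
    (∀ g : BoundedContinuousFunction ℝ ℝ,
      TendstoInMeasure P
        (fun p : ℕ × ℕ => P[fun ω => g (EarlyStopping.stdStat H v X ε α p.1 p.2 ω) |
          EarlyStopping.designSigma X p.1])
        (atTop ×ˢ atTop) (fun _ => ∫ z, g z ∂(gaussianReal 0 1))) ∧
    -- convergence in distribution
    TendstoInDistribution (fun p : ℕ × ℕ => EarlyStopping.stdStat H v X ε α p.1 p.2)
      (atTop ×ˢ atTop) (id : ℝ → ℝ) (fun _ => P) (gaussianReal 0 1) := by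
  refine ⟨fun n t hn => ⟨?_, ?_, ?_⟩, fun g => ?_, ?_⟩
  · exact EarlyStopping.memLp_nullStat hMercer hXm hεm hεlaw hα hn t
  · exact EarlyStopping.condExp_nullStat hMercer hXm hεm hεlaw hεind hXε hα hn t
  · exact EarlyStopping.condVar_nullStat hMercer hXm hεm hεlaw hεind hXε hα hn t
  · exact EarlyStopping.tendstoInMeasure_condExp_stdStat hMercer hXm hXlaw hXind hv hεm hεlaw
      hεind hXε hα hκ g
  · exact EarlyStopping.tendstoInDistribution_stdStat hMercer hXm hXlaw hXind hv hεm hεlaw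
      hεind hXε hα hκ
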